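/- Let $\tau=\frac{1+\sqrt5}{2}$, $\rho=e^{2\pi i/3}$ and let $\mathcal V\subset \mathrm{PGL}_3(\mathbb C)$ be the Valentiner group, generated by the classes of $$Z=\begin{pmatrix}-1&0&0\\0&1&0\\0&0&-1\end{pmatrix},\quad P=\tfrac12\begin{pmatrix}1&\tau^{-1}&-\tau\\ \tau^{-1}&\tau&1\\ \tau&-1&\tau^{-1}\end{pmatrix},\quad Q=\begin{pmatrix}1&0&0\\0&0&\rho^2\\0&-\rho&0\end{pmatrix}.$$ Let $\mathcal V_{1080}\subset \mathrm{SU}_3(\mathbb C)$ be the group of all special unitary matrices whose class lies in $\mathcal V$, and let $\mathcal V_{2160}$ be the group of all unitary matrices of determinant $\pm1$ whose class lies in $\mathcal V$. These groups act on differential $p$-forms on $\mathbb C^3$ with polynomial coefficients by $(T\alpha)(x)=\alpha(T^{-1}x)$, that is, by pullback under $T^{-1}$. For a group $G$ acting in this way let $\Lambda_p(\mathbb C^3)^G_m$ be the space of $G$-invariant $p$-forms whose coefficients are homogeneous of degree $m$, and put $$M(\Lambda_p^G)=\sum_{m\ge0}\dim\Lambda_p(\mathbb C^3)^G_m\,t^m,\qquad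 M(\Lambda^G)=\sum_{p=0}^3 M(\Lambda_p^G)\,s^p .$$ (1) The power series $M(\Lambda_0^{\mathcal V_{2160}})$ is invertible in $\mathbb Z[[t]]$, and $$\frac{M(\Lambda^{\mathcal V_{1080}})}{M(\Lambda_0^{\mathcal V_{2160}})}=(1+t^{45})+(t^5+t^{11}+t^{20}+t^{26}+t^{29}+t^{44})s+(t+t^{16}+t^{19}+t^{25}+t^{34}+t^{40})s^2+(1+t^{45})s^3 .$$ (2) For each $0\le p\le 3$ the coefficient of $s^p$ in this polynomial gives the degrees of the generating $\mathcal V_{1080}$-invariant $p$-forms: if this coefficient is $\sum_i t^{d_i}$, then the module of $\mathcal V_{1080}$-invariant $p$-forms over the ring $\mathbb C[x]^{\mathcal V_{2160}}$ of $\mathcal V_{2160}$-invariant polynomials is free on homogeneous forms of degrees $d_i$. (3) The coefficient of $s^2$ likewise gives the degrees of the generating $\mathcal V_{1080}$-equivariant maps: there are homogeneous polynomial maps $f^{(i)}:\mathbb C^3\to\mathbb C^3$ of degrees $1,16,19,25,34,40$ that form a basis of the module of $\mathcal V_{1080}$-equivariant polynomial maps ($f(Tx)=Tf(x)$) over $\mathbb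 C[x]^{\mathcal V_{2160}}$, and whose associated 2-forms $f^{(i)}_1\,dx_2\wedge dx_3+f^{(i)}_2\,dx_3\wedge dx_1+f^{(i)}_3\,dx_1\wedge dx_2$ form a basis of the module of $\mathcal V_{1080}$-invariant 2-forms. -/

import Mathlib

open scoped Polynomial PowerSeries

noncomputable section

namespace Valentiner

/-! ### The Valentiner group and its two linear lifts -/

/-- The golden ratio `τ = (1 + √5) / 2` as a complex number. -/
def tau : ℂ := (((1 + Real.sqrt 5) / 2 : ℝ) : ℂ)

/-- The primitive cube root of unity `ρ = e^{2πi/3}`. -/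
def rho : ℂ := Complex.exp (2 * Real.pi * Complex.I / 3)

/-- The matrix `Z`. -/
def matZ : Matrix (Fin 3) (Fin 3) ℂ := !![-1, 0, 0; 0, 1, 0; 0, 0, -1]

/-- The matrix `P`; together with `Z` it generates a ternary icosahedral group. -/
def matP : Matrix (Fin 3) (Fin 3) ℂ :=
  (1 / 2 : ℂ) • !![1, tau⁻¹, -tau; tau⁻¹, tau, 1; tau, -1, tau⁻¹]

/-- The matrix `Q`, which extends the icosahedral group to the Valentiner group. -/
def matQ : Matrix (Fin 3) (Fin 3) ℂ := !![1, 0, 0; 0, 0, rho ^ 2; 0, -rho, 0]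

theorem tau_sq : tau ^ 2 = tau + 1 := by
  have h : ((1 + Real.sqrt 5) / 2 : ℝ) ^ 2 = (1 + Real.sqrt 5) / 2 + 1 := by
    have := Real.sq_sqrt (show (0 : ℝ) ≤ 5 by norm_num)
    nlinarith
  unfold tau
  exact_mod_cast h

theorem tau_ne_zero : tau ≠ 0 := by
  intro h
  have := tau_sq
  simp [h] at this

theorem tau_inv : tau⁻¹ = tau - 1 := by
  have h0 := tau_ne_zero
  have h := tau_sq
  field_simp
  linear_combination -h

theorem rho_pow_three : rho ^ 3 = 1 := by
  rw [rho, ← Complex.exp_nat_mul]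
  have : ((3 : ℕ) : ℂ) * (2 * Real.pi * Complex.I / 3) = 2 * Real.pi * Complex.I := by
    push_cast; ring
  rw [this, Complex.exp_two_pi_mul_I]

theorem det_matZ : matZ.det = 1 := by
  simp [matZ, Matrix.det_fin_three]

theorem det_matP : matP.det = 1 := by
  have h := tau_sq
  simp [matP, Matrix.det_fin_three, tau_inv]
  linear_combination (3 / 4 : ℂ) * h

theorem det_matQ : matQ.det = 1 := by
  simp [matQ, Matrix.det_fin_three]
  linear_combination rho_pow_three

/-- A matrix of determinant one as an element of `GL₃(ℂ)`. -/
def toGL (A : Matrix (Fin 3) (Fin 3) ℂ) (h : A.det = 1) : GL (Fin 3) ℂ :=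
  Matrix.GeneralLinearGroup.mkOfDetNeZero A (by rw [h]; exact one_ne_zero)

/-- The projective linear group `PGL₃(ℂ)`. -/
abbrev PGL3 : Type := GL (Fin 3) ℂ ⧸ Subgroup.center (GL (Fin 3) ℂ)

/-- The quotient map `GL₃(ℂ) → PGL₃(ℂ)`. -/
abbrev toPGL : GL (Fin 3) ℂ →* PGL3 := QuotientGroup.mk' (Subgroup.center (GL (Fin 3) ℂ))

/-- The Valentiner group `V ⊂ PGL₃(ℂ)`, generated by the classes of `Z`, `P` and `Q`. -/
def V : Subgroup PGL3 :=
  Subgroup.closure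
    {toPGL (toGL matZ det_matZ), toPGL (toGL matP det_matP), toPGL (toGL matQ det_matQ)}

/-- The 1-to-3 lift of `V` to `SU₃(ℂ)`: all special unitary matrices whose class lies in `V`. -/
def V1080 : Subgroup (GL (Fin 3) ℂ) where
  carrier := {T | (T : Matrix (Fin 3) (Fin 3) ℂ) ∈ Matrix.unitaryGroup (Fin 3) ℂ ∧
    (T : Matrix (Fin 3) (Fin 3) ℂ).det = 1 ∧ toPGL T ∈ V}
  one_mem' := by
    refine ⟨by simp, by simp, by simp⟩
  mul_mem' := by
    rintro a b ⟨ha, ha', ha''⟩ ⟨hb, hb', hb''⟩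
    refine ⟨by simpa using mul_mem ha hb, by simp [ha', hb'], ?_⟩
    rw [map_mul]; exact mul_mem ha'' hb''
  inv_mem' := by
    rintro a ⟨ha, ha', ha''⟩
    refine ⟨?_, ?_, ?_⟩
    · have h : ((a⁻¹ : GL (Fin 3) ℂ) : Matrix (Fin 3) (Fin 3) ℂ)
          = star (a : Matrix (Fin 3) (Fin 3) ℂ) :=
        Units.inv_eq_of_mul_eq_one_right (Unitary.mul_star_self_of_mem ha)
      rw [h]; exact Unitary.star_mem ha
    · simp [ha']
    · rw [map_inv]; exact inv_mem ha''

/-- The 1-to-6 lift of `V` to unitary matrices of determinant `±1` (the unitary reflection group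
generated by 45 involutive reflections). -/
def V2160 : Subgroup (GL (Fin 3) ℂ) where
  carrier := {T | (T : Matrix (Fin 3) (Fin 3) ℂ) ∈ Matrix.unitaryGroup (Fin 3) ℂ ∧
    ((T : Matrix (Fin 3) (Fin 3) ℂ).det = 1 ∨ (T : Matrix (Fin 3) (Fin 3) ℂ).det = -1) ∧
    toPGL T ∈ V}
  one_mem' := by
    refine ⟨by simp, by simp, by simp⟩
  mul_mem' := by
    rintro a b ⟨ha, ha', ha''⟩ ⟨hb, hb', hb''⟩
    refine ⟨by simpa using mul_mem ha hb, ?_, ?_⟩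
    · rcases ha' with ha' | ha' <;> rcases hb' with hb' | hb' <;> simp [ha', hb']
    · rw [map_mul]; exact mul_mem ha'' hb''
  inv_mem' := by
    rintro a ⟨ha, ha', ha''⟩
    refine ⟨?_, ?_, ?_⟩
    · have h : ((a⁻¹ : GL (Fin 3) ℂ) : Matrix (Fin 3) (Fin 3) ℂ)
          = star (a : Matrix (Fin 3) (Fin 3) ℂ) :=
        Units.inv_eq_of_mul_eq_one_right (Unitary.mul_star_self_of_mem ha)
      rw [h]; exact Unitary.star_mem ha
    · rcases ha' with ha' | ha' <;> simp [ha', inv_neg]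
    · rw [map_inv]; exact inv_mem ha''

/-! ### Polynomial differential forms, invariants and equivariants -/

/-- Polynomial functions on `ℂ³`. -/
abbrev Poly : Type := MvPolynomial (Fin 3) ℂ

/-- The linear substitution `f(x) ↦ f(A x)`. -/
def subst (A : Matrix (Fin 3) (Fin 3) ℂ) : Poly →ₐ[ℂ] Poly :=
  MvPolynomial.aeval fun i => ∑ j, MvPolynomial.C (A i j) * MvPolynomial.X j

/-- The ring `ℂ[x]^G` of `G`-invariant polynomials. -/
def invariantRing (G : Subgroup (GL (Fin 3) ℂ)) : Subalgebra ℂ Poly where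
  carrier := {f | ∀ T ∈ G, subst ((T⁻¹ : GL (Fin 3) ℂ) : Matrix (Fin 3) (Fin 3) ℂ) f = f}
  mul_mem' := by
    intro a b ha hb T hT
    rw [map_mul, ha T hT, hb T hT]
  add_mem' := by
    intro a b ha hb T hT
    rw [map_add, ha T hT, hb T hT]
  algebraMap_mem' := by
    intro r T _
    exact AlgHom.commutes _ r

/-- Differential `p`-forms on `ℂ³` with polynomial coefficients: alternating `p`-linear forms on
the vectors of `ℂ³`, with values in the polynomial functions of the base point `x`. -/
abbrev PolyForm (p : ℕ) : Type := (Fin 3 → ℂ) [⋀^Fin p]→ₗ[ℂ] Poly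

/-- The pullback of a form under the linear map `A`:
`(A^* α)(x)(v₁, …, v_p) = α(A x)(A v₁, …, A v_p)`. -/
def pullback (A : Matrix (Fin 3) (Fin 3) ℂ) {p : ℕ} (α : PolyForm p) : PolyForm p :=
  (subst A).toLinearMap.compAlternatingMap (α.compLinearMap (Matrix.toLin' A))

/-- The action `(T α)(x) = α(T⁻¹ x)` on forms, i.e. pullback under `T⁻¹`. -/
def act (T : GL (Fin 3) ℂ) {p : ℕ} (α : PolyForm p) : PolyForm p :=
  pullback ((T⁻¹ : GL (Fin 3) ℂ) : Matrix (Fin 3) (Fin 3) ℂ) α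

/-- The space of `G`-invariant `p`-forms. -/
def invariantForms (G : Subgroup (GL (Fin 3) ℂ)) (p : ℕ) : Submodule ℂ (PolyForm p) where
  carrier := {α | ∀ T ∈ G, act T α = α}
  zero_mem' := by
    intro T _
    ext v
    simp [act, pullback]
  add_mem' := by
    intro a b ha hb T hT
    have h : act T (a + b) = act T a + act T b := by
      ext v
      simp [act, pullback]
    rw [h, ha T hT, hb T hT]
  smul_mem' := by
    intro c a ha T hT
    have h : act T (c • a) = c • act T a := by
      ext v
      simp [act, pullback]
    rw [h, ha T hT]

/-- The `p`-forms all of whose coefficients are homogeneous polynomials of degree `m`. -/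
def homogeneousForms (p m : ℕ) : Submodule ℂ (PolyForm p) where
  carrier := {α | ∀ v, α v ∈ MvPolynomial.homogeneousSubmodule (Fin 3) ℂ m}
  zero_mem' := fun _ => Submodule.zero_mem _
  add_mem' := fun ha hb v => Submodule.add_mem _ (ha v) (hb v)
  smul_mem' := fun c _ ha v => Submodule.smul_mem _ c (ha v)

/-- The 2-form `f₁ dx₂∧dx₃ + f₂ dx₃∧dx₁ + f₃ dx₁∧dx₂` of a polynomial map `f = (f₁, f₂, f₃)`;
its value on `(v, w)` is `f · (v × w)`. -/
def twoForm (f : Fin 3 → Poly) : PolyForm 2 :=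
  AlternatingMap.mk
    { toFun := fun v => ∑ i, (crossProduct (v 0) (v 1)) i • f i
      map_update_add' := by
        intro _ v i x y
        fin_cases i <;> simp [← Finset.sum_add_distrib, add_smul]
      map_update_smul' := by
        intro _ v i c x
        fin_cases i <;> simp [Finset.smul_sum, mul_smul] }
    (by
      intro v i j hij hne
      have h : v 0 = v 1 := by
        fin_cases i <;> fin_cases j <;> simp_all
      simp [h])

/-- A polynomial map `f : ℂ³ → ℂ³` is `G`-equivariant: `f(T x) = T f(x)` for all `T ∈ G`. -/
def IsEquivariant (G : Subgroup (GL (Fin 3) ℂ)) (f : Fin 3 → Poly) : Prop :=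
  ∀ T ∈ G, ∀ i, subst (T : Matrix (Fin 3) (Fin 3) ℂ) (f i) =
    ∑ j, (T : Matrix (Fin 3) (Fin 3) ℂ) i j • f j

/-! ### Exterior Molien series -/

/-- The series `M(Λ_p^G) = ∑_m (dim Λ_p(ℂ³)_m^G) t^m`. -/
def molienSeries (G : Subgroup (GL (Fin 3) ℂ)) (p : ℕ) : ℤ⟦X⟧ :=
  PowerSeries.mk fun m =>
    (Module.finrank ℂ ↥(invariantForms G p ⊓ homogeneousForms p m) : ℤ)

/-- The two-variable exterior Molien series `M(Λ^G) = ∑_{p=0}^{3} M(Λ_p^G) s^p`, a polynomial in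
`s` whose coefficients are power series in `t`. -/
def exteriorMolienSeries (G : Subgroup (GL (Fin 3) ℂ)) : (ℤ⟦X⟧)[X] :=
  ∑ p ∈ Finset.range 4, Polynomial.C (molienSeries G p) * Polynomial.X ^ p

/-- The polynomial
`(1+t^45) + (t^5+t^11+t^20+t^26+t^29+t^44) s + (t+t^16+t^19+t^25+t^34+t^40) s^2 + (1+t^45) s^3`,
as a polynomial in `s` with coefficients in `ℤ[t]`. -/
def quotientPolynomial : ℤ[X][X] :=
  let t : ℤ[X] := Polynomial.X
  let s : ℤ[X][X] := Polynomial.X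
  Polynomial.C (1 + t ^ 45)
    + Polynomial.C (t ^ 5 + t ^ 11 + t ^ 20 + t ^ 26 + t ^ 29 + t ^ 44) * s
    + Polynomial.C (t + t ^ 16 + t ^ 19 + t ^ 25 + t ^ 34 + t ^ 40) * s ^ 2
    + Polynomial.C (1 + t ^ 45) * s ^ 3

/-- The family `b` is a basis, over the ring `R`, of the set `N` (which is then an `R`-submodule
of `M`). -/
def IsBasisOf (R : Type) {M ι : Type} [Semiring R] [AddCommMonoid M] [Module R M]
    (b : ι → M) (N : Set M) : Prop :=
  LinearIndependent R b ∧ (Submodule.span R (Set.range b) : Set M) = N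

end Valentiner

end

/-!
Write `H` for `V1080`, `G = H ∪ -H` for `V2160` and `S` for the ring of `G`-invariant polynomials.
Every `H`-invariant object splits into an even and an odd part under `x ↦ -x`. For polynomials the
even part is `G`-invariant and the odd part is *skew*, that is, `G` acts on it by the determinant.

The key fact is `IsSkew.exists_eq_mul`: a nonzero skew form `D` of degree `45` divides every skew
polynomial, with quotient in `S`. Indeed `G` contains the reflection `-Z`, so skew polynomials
vanish on its mirror `x₂ = 0`, and hence on the whole orbit of this mirror under the group. The
orbit consists of `45` planes, whose linear forms are pairwise non-associated primes, so their
product divides each skew polynomial, and `D` is a constant multiple of the product. It suffices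
that the orbit has as many as `45` members, which is an exact computation with vectors over
`ℤ[τ, ρ]` (`length_mirrors`, `pairwise_mirrors`).

There is an explicit `G`-invariant sextic `F₆`. Its Hessian determinant `F₁₂` and the bordered
Hessian `F₃₀ = ∇F₁₂ · adj(Hess F₆) ∇F₁₂` are invariant too, and
`x`, `adj(Hess F₆) ∇F₁₂`, `adj(Hess F₁₂) ∇F₆` are `G`-equivariant vector fields of degrees
`1, 19, 25`. The determinant of the three gradients and that of the three fields are skew of degree
`45`, and they do not vanish: both are evaluated exactly at the point `(1, 1, 2)`, which shows
`jacobian_ne_zero` and `fieldDet_ne_zero`. Neither `S = ℂ[F₆, F₁₂, F₃₀]` nor the order of the group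
is used.

By Cramer's rule an odd invariant 1-form is a combination of the three gradients whose coefficients
are quotients of skew polynomials by the Jacobian, hence lie in `S`; an even one is in the same way
a combination of the cross products of the three vector fields. Exchanging the two triples gives
the equivariant vector fields, which are the invariant 2-forms (`isBasisOf_six`). The invariant
functions and the invariant 3-forms have the basis `1`, Jacobian (`isBasisOf_scalarModule`).
The Molien series are counted from these homogeneous bases (`IsBasisOf.finrank_eq`).
-/

noncomputable section

namespace Valentiner

theorem rho_sq : rho ^ 2 = -1 - rho := by
  have h1 : rho ≠ 1 := by
    intro h
    rw [rho, Complex.exp_eq_one_iff] at h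
    obtain ⟨n, hn⟩ := h
    have hpi : (2 * Real.pi * Complex.I : ℂ) ≠ 0 := Complex.two_pi_I_ne_zero
    have h3 : (1 : ℂ) = ((3 * n : ℤ) : ℂ) := by
      apply mul_right_cancel₀ hpi
      push_cast
      linear_combination 3 * hn
    have : (1 : ℤ) = 3 * n := by exact_mod_cast h3
    omega
  apply mul_left_cancel₀ (sub_ne_zero.2 h1)
  linear_combination rho_pow_three

/-! ### Exact arithmetic in `ℤ[τ, ρ]` -/

/-- The number `a + b τ + c ρ + d τ ρ` of `ℤ[τ, ρ]`, given by its four integer coordinates. -/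
structure GoldenEisenstein where
  a : ℤ
  b : ℤ
  c : ℤ
  d : ℤ
deriving DecidableEq

namespace GoldenEisenstein

instance : Add GoldenEisenstein := ⟨fun x y => ⟨x.a + y.a, x.b + y.b, x.c + y.c, x.d + y.d⟩⟩

instance : Neg GoldenEisenstein := ⟨fun x => ⟨-x.a, -x.b, -x.c, -x.d⟩⟩

instance : Mul GoldenEisenstein := ⟨fun x y =>
  ⟨x.a * y.a + x.b * y.b - x.c * y.c - x.d * y.d,
    x.a * y.b + x.b * y.a + x.b * y.b - x.c * y.d - x.d * y.c - x.d * y.d,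
    x.a * y.c + x.b * y.d + x.c * y.a + x.d * y.b - x.c * y.c - x.d * y.d,
    x.a * y.d + x.b * y.c + x.b * y.d + x.c * y.b + x.d * y.a + x.d * y.b
      - x.c * y.d - x.d * y.c - x.d * y.d⟩⟩

instance : Zero GoldenEisenstein := ⟨⟨0, 0, 0, 0⟩⟩

/-- The complex number with the given coordinates. -/
def toComplex (x : GoldenEisenstein) : ℂ := x.a + x.b * tau + x.c * rho + x.d * tau * rho

theorem toComplex_add (x y : GoldenEisenstein) :
    (x + y).toComplex = x.toComplex + y.toComplex := by
  change toComplex ⟨_, _, _, _⟩ = _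
  simp only [toComplex]
  push_cast
  ring

theorem toComplex_neg (x : GoldenEisenstein) : (-x).toComplex = -x.toComplex := by
  change toComplex ⟨_, _, _, _⟩ = _
  simp only [toComplex]
  push_cast
  ring

theorem toComplex_mul (x y : GoldenEisenstein) :
    (x * y).toComplex = x.toComplex * y.toComplex := by
  change toComplex ⟨_, _, _, _⟩ = _
  have ht := tau_sq
  have hr := rho_sq
  simp only [toComplex]
  push_cast
  grind

theorem toComplex_zero : (0 : GoldenEisenstein).toComplex = 0 := by
  change toComplex ⟨0, 0, 0, 0⟩ = 0
  simp [toComplex]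

/-- The numbers `1, τ, ρ, τ ρ` are linearly independent over `ℤ`. -/
theorem toComplex_injective : Function.Injective toComplex := by
  intro x y h
  obtain ⟨g, hg, htau⟩ : ∃ g : ℝ, Irrational g ∧ tau = g :=
    ⟨Real.goldenRatio, Real.goldenRatio_irrational, rfl⟩
  have hirr (m n : ℤ) (hmn : (m : ℝ) + n * g = 0) : m = 0 ∧ n = 0 := by
    have hn : n = 0 := by
      by_contra hn
      refine hg ⟨-m / n, ?_⟩
      have hn' : (n : ℝ) ≠ 0 := by exact_mod_cast hn
      push_cast
      field_simp
      linarith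
    subst hn
    simpa using hmn
  have him : rho.im ≠ 0 := by
    intro h0
    have hr : (rho.re : ℂ) = rho := Complex.ext rfl (by simp [h0])
    have hsq := rho_sq
    rw [← hr] at hsq
    have hsq' : rho.re ^ 2 = -1 - rho.re := by exact_mod_cast hsq
    nlinarith [sq_nonneg (rho.re + 1 / 2)]
  have h1 : ((x.a - y.a + (x.b - y.b) * g : ℝ) : ℂ)
      + ((x.c - y.c + (x.d - y.d) * g : ℝ) : ℂ) * rho = 0 := by
    simp only [toComplex, htau] at h
    push_cast
    linear_combination h
  have h2 := congrArg Complex.im h1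
  rw [Complex.add_im, Complex.ofReal_im, Complex.im_ofReal_mul, zero_add, Complex.zero_im] at h2
  have h3 := (mul_eq_zero.1 h2).resolve_right him
  rw [h3, Complex.ofReal_zero, zero_mul, add_zero] at h1
  have h4 := hirr (x.a - y.a) (x.b - y.b) (by push_cast; exact_mod_cast h1)
  have h5 := hirr (x.c - y.c) (x.d - y.d) (by push_cast; exact h3)
  obtain ⟨a, b, c, d⟩ := x
  obtain ⟨a', b', c', d'⟩ := y
  simp only [mk.injEq]
  simp only at h4 h5
  omega

end GoldenEisenstein
open GoldenEisenstein

/-! ### The forty-five mirrors -/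

/-- A vector with coordinates in `ℤ[τ, ρ]`. -/
abbrev GEVector : Type := GoldenEisenstein × GoldenEisenstein × GoldenEisenstein

namespace GEVector

/-- The row vector `v * (2 • P)`. -/
def mulP (v : GEVector) : GEVector :=
  (v.1 + ⟨-1, 1, 0, 0⟩ * v.2.1 + ⟨0, 1, 0, 0⟩ * v.2.2,
    ⟨-1, 1, 0, 0⟩ * v.1 + ⟨0, 1, 0, 0⟩ * v.2.1 + -v.2.2,
    ⟨0, -1, 0, 0⟩ * v.1 + v.2.1 + ⟨-1, 1, 0, 0⟩ * v.2.2)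

/-- The row vector `v * Q`. -/
def mulQ (v : GEVector) : GEVector :=
  (v.1, ⟨0, 0, -1, 0⟩ * v.2.2, ⟨-1, 0, -1, 0⟩ * v.2.1)

/-- Two vectors are parallel if their cross product vanishes. -/
def Parallel (v w : GEVector) : Prop :=
  v.1 * w.2.1 = w.1 * v.2.1 ∧ v.1 * w.2.2 = w.1 * v.2.2 ∧ v.2.1 * w.2.2 = w.2.1 * v.2.2

instance : DecidableRel Parallel := fun v w => by unfold Parallel; infer_instance

/-- Adds a vector to a list unless the list has a parallel one. -/
def insertNew (l : List GEVector) (v : GEVector) : List GEVector :=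
  if ∀ w ∈ l, ¬ Parallel w v then v :: l else l

/-- Adds to a list the images of its members under `P` and `Q`, up to proportionality. -/
def grow (l : List GEVector) : List GEVector :=
  l.foldl (fun m v => insertNew (insertNew m v.mulP) v.mulQ) l

end GEVector
open GEVector

/-- The normals of the reflection planes: the orbit, up to proportionality, of the normal of the
plane `x₂ = 0`. Seven rounds reach the whole orbit. -/
def mirrors : List GEVector := grow^[7] [(0, ⟨1, 0, 0, 0⟩, 0)]

theorem length_mirrors : mirrors.length = 45 := by decide +kernel

theorem pairwise_mirrors : mirrors.Pairwise fun v w => ¬ Parallel v w := by decide +kernel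

theorem ne_zero_of_mem_mirrors : ∀ v ∈ mirrors, v ≠ 0 := by decide +kernel

/-- A property of vectors that holds for the normal of `x₂ = 0` and is preserved by `P` and `Q`
holds for all mirrors. -/
theorem mirrors_induction {p : GEVector → Prop} (h0 : p (0, ⟨1, 0, 0, 0⟩, 0))
    (hP : ∀ v, p v → p v.mulP) (hQ : ∀ v, p v → p v.mulQ) : ∀ v ∈ mirrors, p v := by
  have hins (l : List GEVector) (v : GEVector) (hl : ∀ w ∈ l, p w) (hv : p v) :
      ∀ w ∈ insertNew l v, p w := by
    intro w hw
    unfold insertNew at hw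
    split_ifs at hw
    · rcases List.mem_cons.1 hw with rfl | hw
      exacts [hv, hl w hw]
    · exact hl w hw
  have hfold (l m : List GEVector) (hl : ∀ w ∈ l, p w) (hm : ∀ w ∈ m, p w) :
      ∀ w ∈ l.foldl (fun m v => insertNew (insertNew m v.mulP) v.mulQ) m, p w := by
    induction l generalizing m with
    | nil => exact hm
    | cons v l ih =>
      have hv := hl v (by simp)
      exact ih _ (fun w hw => hl w (by simp [hw]))
        (hins _ _ (hins _ _ hm (hP v hv)) (hQ v hv))
  have hiter (n : ℕ) : ∀ w ∈ grow^[n] [(0, ⟨1, 0, 0, 0⟩, 0)], p w := by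
    induction n with
    | zero => simpa using h0
    | succ n ih =>
      rw [Function.iterate_succ_apply']
      exact hfold _ _ ih ih
  exact hiter 7

open MvPolynomial Matrix GoldenEisenstein

/-! ### Linear substitutions -/

theorem subst_X (A : Matrix (Fin 3) (Fin 3) ℂ) (i : Fin 3) :
    subst A (X i) = ∑ j, C (A i j) * X j := by
  simp [subst]

theorem subst_C (A : Matrix (Fin 3) (Fin 3) ℂ) (c : ℂ) : subst A (C c) = C c :=
  AlgHom.commutes _ c

theorem subst_subst (A B : Matrix (Fin 3) (Fin 3) ℂ) (f : Poly) :
    subst A (subst B f) = subst (B * A) f := by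
  have h : (subst A).comp (subst B) = subst (B * A) := by
    ext1 i
    simp only [AlgHom.comp_apply, subst_X, map_sum, map_mul, subst_C, Finset.mul_sum,
      Matrix.mul_apply, Finset.sum_mul, mul_assoc]
    exact Finset.sum_comm
  exact DFunLike.congr_fun h f

theorem subst_one (f : Poly) : subst 1 f = f := by
  have h : subst 1 = AlgHom.id ℂ Poly := by
    ext1 i
    simp [subst_X, Matrix.one_apply]
  exact DFunLike.congr_fun h f

/-- A scalar `c` acts on polynomials of degree `n` by `c ^ n`. -/
theorem subst_smul_one (c : ℂ) {f : Poly} {n : ℕ} (hf : f.IsHomogeneous n) :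
    subst (c • 1) f = C (c ^ n) * f := by
  have h (i : Fin 3) : ∑ j, C ((c • (1 : Matrix (Fin 3) (Fin 3) ℂ)) i j) * X j
      = (C c * X i : Poly) := by
    simp [Matrix.one_apply, apply_ite C, ite_mul]
  have hm (d : Fin 3 →₀ ℕ) (a : ℂ) (hd : d.degree = n) :
      subst (c • 1) (monomial d a) = C (c ^ n) * monomial d a := by
    rw [subst, aeval_monomial, ← hd]
    simp only [h, mul_pow, Finsupp.prod_mul, algebraMap_eq]
    rw [monomial_eq (a := a), Finsupp.degree_eq_sum, Finsupp.prod_fintype _ _ (by simp),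
      ← Finset.prod_pow_eq_pow_sum, map_prod]
    simp only [map_pow]
    ring
  conv_lhs => rw [f.as_sum]
  conv_rhs => rw [f.as_sum]
  rw [map_sum, Finset.mul_sum]
  refine Finset.sum_congr rfl fun d hd => hm d _ ?_
  by_contra hne
  exact (mem_support_iff.1 hd) (hf.coeff_eq_zero hne)

theorem subst_smul (c : ℂ) (A : Matrix (Fin 3) (Fin 3) ℂ) {f : Poly} {n : ℕ}
    (hf : f.IsHomogeneous n) : subst (c • A) f = C (c ^ n) * subst A f := by
  have h : c • A = (c • 1) * A := by simp
  rw [h, ← subst_subst, subst_smul_one c hf, map_mul, subst_C]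

theorem subst_isHomogeneous (A : Matrix (Fin 3) (Fin 3) ℂ) {f : Poly} {n : ℕ}
    (hf : f.IsHomogeneous n) : (subst A f).IsHomogeneous n := by
  have h := hf.aeval (fun i => ∑ j, C (A i j) * X j) (n := 1) fun i =>
    IsHomogeneous.sum _ _ _ fun j _ => isHomogeneous_C_mul_X (A i j) j
  simpa [subst] using h

theorem homogeneousComponent_subst (A : Matrix (Fin 3) (Fin 3) ℂ) (n : ℕ) (f : Poly) :
    homogeneousComponent n (subst A f) = subst A (homogeneousComponent n f) := by
  conv_lhs => rw [← sum_homogeneousComponent f, map_sum, map_sum]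
  have h (k : ℕ) : homogeneousComponent n (subst A (homogeneousComponent k f))
      = if k = n then subst A (homogeneousComponent n f) else 0 := by
    rw [homogeneousComponent_of_mem
      (subst_isHomogeneous A (homogeneousComponent_isHomogeneous k f))]
    by_cases hk : k = n
    · simp [hk]
    · simp [hk, Ne.symm hk]
  simp only [h, Finset.sum_ite_eq', Finset.mem_range]
  split_ifs with hn
  · rfl
  · rw [homogeneousComponent_eq_zero _ _ (by omega), map_zero]

/-- The chain rule for a linear substitution. -/
theorem pderiv_subst (A : Matrix (Fin 3) (Fin 3) ℂ) (j : Fin 3) (f : Poly) :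
    pderiv j (subst A f) = ∑ i, C (A i j) * subst A (pderiv i f) := by
  induction f using MvPolynomial.induction_on with
  | C a => simp
  | add p q hp hq => simp only [map_add, hp, hq, mul_add, Finset.sum_add_distrib]
  | mul_X p k hp =>
    have hX : pderiv j (subst A (X k)) = C (A k j) := by
      simp [subst_X, pderiv_X, Pi.single_apply, Derivation.leibniz]
    have hd (i : Fin 3) :
        pderiv i (p * X k) = (if i = k then p else 0) + pderiv i p * X k := by
      rw [pderiv_mul, pderiv_X, Pi.single_apply, add_comm]
      by_cases h : i = k
      · simp [h]
      · simp [h, Ne.symm h]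
    rw [map_mul, pderiv_mul, hp, hX]
    simp only [hd, map_add, map_mul, mul_add, Finset.sum_add_distrib, apply_ite (subst A), map_zero,
      mul_ite, mul_zero, Finset.sum_ite_eq', Finset.mem_univ, if_true, Finset.sum_mul, mul_assoc]
    rw [add_comm, mul_comm (C (A k j))]

/-! ### Equivariant vector fields and covector fields -/

/-- The constant matrix `A` with polynomial entries. -/
abbrev constMatrix (A : Matrix (Fin 3) (Fin 3) ℂ) : Matrix (Fin 3) (Fin 3) Poly := A.map C

/-- The vector field `f` satisfies `f(A x) = A f(x)`. -/
def IsVec (A : Matrix (Fin 3) (Fin 3) ℂ) (f : Fin 3 → Poly) : Prop :=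
  subst A ∘ f = constMatrix A *ᵥ f

/-- The covector field (differential 1-form) `w` satisfies `Aᵀ w(A x) = w(x)`, that is, `w` is
its own pullback under `A`. -/
def IsCov (A : Matrix (Fin 3) (Fin 3) ℂ) (w : Fin 3 → Poly) : Prop :=
  (subst A ∘ w) ᵥ* constMatrix A = w

/-- The gradient of a polynomial. -/
def grad (f : Poly) (i : Fin 3) : Poly := pderiv i f

/-- The Hessian matrix of a polynomial. -/
def hess (f : Poly) : Matrix (Fin 3) (Fin 3) Poly := Matrix.of fun i j => pderiv i (pderiv j f)

theorem det_constMatrix {A : Matrix (Fin 3) (Fin 3) ℂ} (hA : A.det = 1) :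
    (constMatrix A).det = 1 := by
  have h := RingHom.map_det (C : ℂ →+* Poly) A
  rw [hA, map_one] at h
  exact h.symm

theorem subst_dotProduct (A : Matrix (Fin 3) (Fin 3) ℂ) (v w : Fin 3 → Poly) :
    subst A (v ⬝ᵥ w) = (subst A ∘ v) ⬝ᵥ (subst A ∘ w) := by
  simp [dotProduct]

theorem subst_cross (A : Matrix (Fin 3) (Fin 3) ℂ) (v w : Fin 3 → Poly) :
    subst A ∘ (crossProduct v w) = crossProduct (subst A ∘ v) (subst A ∘ w) := by
  ext1 i
  fin_cases i <;> simp [cross_apply]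

theorem cross_mulVec_vecMul {R : Type*} [CommRing R] (M : Matrix (Fin 3) (Fin 3) R)
    (v w : Fin 3 → R) : crossProduct (M *ᵥ v) (M *ᵥ w) ᵥ* M = M.det • crossProduct v w := by
  ext1 i
  fin_cases i <;>
    simp [cross_apply, vecMul, mulVec, dotProduct, Fin.sum_univ_three, det_fin_three] <;> ring

theorem mulVec_cross_vecMul {R : Type*} [CommRing R] (M : Matrix (Fin 3) (Fin 3) R)
    (v w : Fin 3 → R) : M *ᵥ crossProduct (v ᵥ* M) (w ᵥ* M) = M.det • crossProduct v w := by
  ext1 i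
  fin_cases i <;>
    simp [cross_apply, vecMul, mulVec, dotProduct, Fin.sum_univ_three, det_fin_three] <;> ring

section

variable {A : Matrix (Fin 3) (Fin 3) ℂ}

theorem IsCov.dotProduct {w f : Fin 3 → Poly} (hw : IsCov A w) (hf : IsVec A f) :
    subst A (w ⬝ᵥ f) = w ⬝ᵥ f := by
  rw [subst_dotProduct, hf, dotProduct_mulVec, hw]

theorem IsVec.cross (hA : A.det = 1) {v w : Fin 3 → Poly} (hv : IsVec A v) (hw : IsVec A w) :
    IsCov A (crossProduct v w) := by
  rw [IsCov, subst_cross, hv, hw, cross_mulVec_vecMul, det_constMatrix hA, one_smul]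

theorem IsCov.cross (hA : A.det = 1) {v w : Fin 3 → Poly} (hv : IsCov A v) (hw : IsCov A w) :
    IsVec A (crossProduct v w) := by
  rw [IsVec]
  conv_rhs => rw [← hv, ← hw]
  rw [mulVec_cross_vecMul, det_constMatrix hA, one_smul, subst_cross]

theorem isVec_X : IsVec A X := by
  ext1 i
  simp [subst_X, mulVec, dotProduct]

theorem grad_subst (f : Poly) : grad (subst A f) = (subst A ∘ grad f) ᵥ* constMatrix A := by
  ext1 j
  simp [grad, pderiv_subst, vecMul, dotProduct, mul_comm]

theorem isCov_grad {f : Poly} (hf : subst A f = f) : IsCov A (grad f) := by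
  rw [IsCov, ← grad_subst, hf]

theorem hess_subst (f : Poly) :
    hess (subst A f) = (constMatrix A)ᵀ * (hess f).map (subst A) * constMatrix A := by
  ext1 i j
  simp only [hess, of_apply, pderiv_subst, map_sum, pderiv_C_mul, mul_apply, transpose_apply,
    map_apply, Finset.mul_sum, Finset.sum_mul]
  refine Finset.sum_congr rfl fun k _ => Finset.sum_congr rfl fun l _ => by ring

theorem hess_eq_of_invariant {f : Poly} (hf : subst A f = f) :
    (constMatrix A)ᵀ * (hess f).map (subst A) * constMatrix A = hess f := by
  rw [← hess_subst, hf]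

theorem subst_det_hess (hA : A.det = 1) {f : Poly} (hf : subst A f = f) :
    subst A (hess f).det = (hess f).det := by
  conv_rhs => rw [← hess_eq_of_invariant hf]
  rw [det_mul, det_mul, det_transpose, det_constMatrix hA, one_mul, mul_one]
  exact RingHom.map_det (subst A).toRingHom (hess f)

/-- The adjugate of the Hessian of an invariant turns covector fields into vector fields. -/
theorem IsCov.adjugate_hess_mulVec (hA : A.det = 1) {f : Poly} (hf : subst A f = f)
    {w : Fin 3 → Poly} (hw : IsCov A w) : IsVec A ((hess f).adjugate *ᵥ w) := by
  have hM := det_constMatrix hA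
  have h1 : subst A ∘ ((hess f).adjugate *ᵥ w)
      = ((hess f).map (subst A)).adjugate *ᵥ (subst A ∘ w) := by
    have h := RingHom.map_adjugate (subst A).toRingHom (hess f)
    have h' := RingHom.map_mulVec (subst A).toRingHom (hess f).adjugate w
    ext1 i
    refine (h' i).trans ?_
    exact congrFun (congrArg (· *ᵥ (subst A ∘ w)) h) i
  rw [IsVec, h1]
  conv_rhs => rw [← hess_eq_of_invariant hf, ← hw]
  rw [adjugate_mul_distrib, adjugate_mul_distrib, ← mulVec_transpose, mulVec_mulVec, mulVec_mulVec]
  congr 1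
  rw [Matrix.mul_assoc, Matrix.mul_assoc, Matrix.mul_assoc, adjugate_mul, det_transpose, hM,
    one_smul, Matrix.mul_one, ← Matrix.mul_assoc, mul_adjugate, hM, one_smul, Matrix.one_mul]

end

/-! ### The generators and the two lifts of the Valentiner group -/

theorem star_tau : star tau = tau := Complex.conj_ofReal _

theorem star_rho : star rho = rho ^ 2 := by
  have h : star rho * rho = 1 := by
    rw [rho, Complex.star_def, ← Complex.exp_conj, ← Complex.exp_add, Complex.exp_eq_one_iff]
    refine ⟨0, ?_⟩
    simp only [map_div₀, map_mul, Complex.conj_I, Complex.conj_ofReal, map_ofNat]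
    push_cast
    ring
  have h0 : rho ≠ 0 := Complex.exp_ne_zero _
  apply mul_right_cancel₀ h0
  linear_combination h - rho_pow_three

theorem matZ_mem_unitaryGroup : matZ ∈ unitaryGroup (Fin 3) ℂ := by
  rw [mem_unitaryGroup_iff]
  ext i j
  fin_cases i <;> fin_cases j <;>
    simp [matZ, Matrix.mul_apply, Fin.sum_univ_three, star_apply]

theorem matP_mem_unitaryGroup : matP ∈ unitaryGroup (Fin 3) ℂ := by
  have h := tau_sq
  have hs : (starRingEnd ℂ) tau = tau := star_tau
  have h2 : (starRingEnd ℂ) 2 = 2 := map_ofNat _ 2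
  rw [mem_unitaryGroup_iff]
  ext i j
  fin_cases i <;> fin_cases j <;>
    simp [matP, Matrix.mul_apply, Fin.sum_univ_three, star_apply, tau_inv, hs, h2] <;> grind

theorem matQ_mem_unitaryGroup : matQ ∈ unitaryGroup (Fin 3) ℂ := by
  have h := rho_pow_three
  have hs : (starRingEnd ℂ) rho = rho ^ 2 := star_rho
  rw [mem_unitaryGroup_iff]
  ext i j
  fin_cases i <;> fin_cases j <;>
    simp [matQ, Matrix.mul_apply, Fin.sum_univ_three, star_apply, hs] <;> grind

theorem toGL_matZ_mem : toGL matZ det_matZ ∈ V1080 :=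
  ⟨matZ_mem_unitaryGroup, det_matZ, Subgroup.subset_closure (by simp)⟩

theorem toGL_matP_mem : toGL matP det_matP ∈ V1080 :=
  ⟨matP_mem_unitaryGroup, det_matP, Subgroup.subset_closure (by simp)⟩

theorem toGL_matQ_mem : toGL matQ det_matQ ∈ V1080 :=
  ⟨matQ_mem_unitaryGroup, det_matQ, Subgroup.subset_closure (by simp)⟩

theorem V1080_le_V2160 : V1080 ≤ V2160 := fun _ hT => ⟨hT.1, Or.inl hT.2.1, hT.2.2⟩

theorem toPGL_neg (T : GL (Fin 3) ℂ) : toPGL (-T) = toPGL T := by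
  have h : (-1 : GL (Fin 3) ℂ) ∈ Subgroup.center (GL (Fin 3) ℂ) := by
    rw [Subgroup.mem_center_iff]
    intro g
    simp
  have h1 : toPGL (-1) = 1 := (QuotientGroup.eq_one_iff _).2 h
  rw [← neg_one_mul, map_mul, h1, one_mul]

theorem neg_mem_V2160 {T : GL (Fin 3) ℂ} (hT : T ∈ V2160) : -T ∈ V2160 := by
  refine ⟨?_, ?_, ?_⟩
  · rw [Units.val_neg, mem_unitaryGroup_iff, star_neg, neg_mul_neg]
    exact mem_unitaryGroup_iff.1 hT.1
  · rw [Units.val_neg, det_neg]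
    rcases hT.2.1 with h | h <;> norm_num [h]
  · rw [toPGL_neg]
    exact hT.2.2

theorem mem_V1080_or_neg_mem {T : GL (Fin 3) ℂ} (hT : T ∈ V2160) : T ∈ V1080 ∨ -T ∈ V1080 := by
  rcases hT.2.1 with h | h
  · exact Or.inl ⟨hT.1, h, hT.2.2⟩
  · refine Or.inr ⟨(neg_mem_V2160 hT).1, ?_, (neg_mem_V2160 hT).2.2⟩
    rw [Units.val_neg, det_neg, h]
    norm_num

/-- An element of `V2160` is a sixth root of unity times a product of the generators. -/
theorem exists_smul_of_mem_V2160 {T : GL (Fin 3) ℂ} (hT : T ∈ V2160) :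
    ∃ (c : ℂ) (W : GL (Fin 3) ℂ), c ^ 6 = 1 ∧
      W ∈ Subgroup.closure {toGL matZ det_matZ, toGL matP det_matP, toGL matQ det_matQ} ∧
      (T : Matrix (Fin 3) (Fin 3) ℂ) = c • (W : Matrix (Fin 3) (Fin 3) ℂ) := by
  have hV : V = (Subgroup.closure
      {toGL matZ det_matZ, toGL matP det_matP, toGL matQ det_matQ}).map toPGL := by
    rw [MonoidHom.map_closure, V]
    congr 1
    simp [Set.image_insert_eq]
  obtain ⟨hu, hdet, hcl⟩ := hT
  rw [hV] at hcl
  obtain ⟨W, hW, hWT⟩ := hcl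
  have hWT' : W⁻¹ * T ∈ Subgroup.center (GL (Fin 3) ℂ) := QuotientGroup.eq.1 hWT
  rw [GeneralLinearGroup.mem_center_iff_val_mem_range_scalar] at hWT'
  obtain ⟨c, hc⟩ := hWT'
  have hTW : (T : Matrix (Fin 3) (Fin 3) ℂ) = c • (W : Matrix (Fin 3) (Fin 3) ℂ) := by
    have h : (T : Matrix (Fin 3) (Fin 3) ℂ) = (W * (W⁻¹ * T) : GL (Fin 3) ℂ) := by simp
    rw [h, Units.val_mul, ← hc, scalar_apply, ← smul_one_eq_diagonal, Matrix.mul_smul,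
      Matrix.mul_one]
  have hdetW : (W : Matrix (Fin 3) (Fin 3) ℂ).det = 1 := by
    have h : Subgroup.closure {toGL matZ det_matZ, toGL matP det_matP, toGL matQ det_matQ}
        ≤ (GeneralLinearGroup.det : GL (Fin 3) ℂ →* ℂˣ).ker := by
      rw [Subgroup.closure_le]
      rintro g (rfl | rfl | rfl) <;> refine Units.ext ?_
      exacts [det_matZ, det_matP, det_matQ]
    exact congrArg Units.val (h hW)
  refine ⟨c, W, ?_, hW, hTW⟩
  rw [hTW, det_smul, hdetW, Fintype.card_fin, mul_one] at hdet
  rcases hdet with h | h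
  · linear_combination (c ^ 3 + 1) * h
  · linear_combination (c ^ 3 - 1) * h

/-! ### The invariant sextic -/

/-- The invariant polynomial of degree six. The icosahedral group generated by `Z` and `P` has two
independent invariants of this degree, the cube of the quadratic form and the product of the linear
forms of the six fivefold axes; this is the combination that is also invariant under `Q`, scaled to
coefficients in `ℤ[τ, ρ]`. -/
def sextic : Poly :=
  C 2 * (X 0 ^ 6 + X 1 ^ 6 + X 2 ^ 6)
    + C (-3 + 6 * tau - 9 * rho + 3 * tau * rho)
      * (X 0 ^ 4 * X 1 ^ 2 + X 1 ^ 4 * X 2 ^ 2 + X 2 ^ 4 * X 0 ^ 2)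
    + C (9 - 3 * tau + 6 * rho + 3 * tau * rho)
      * (X 0 ^ 2 * X 1 ^ 4 + X 1 ^ 2 * X 2 ^ 4 + X 2 ^ 2 * X 0 ^ 4)
    + C (36 - 12 * tau + 12 * rho - 24 * tau * rho) * (X 0 ^ 2 * X 1 ^ 2 * X 2 ^ 2)

theorem isHomogeneous_sextic : sextic.IsHomogeneous 6 := by
  have h (a b c : ℕ) (habc : a + b + c = 6) :
      (X 0 ^ a * X 1 ^ b * X 2 ^ c : Poly).IsHomogeneous 6 := by
    rw [← habc]
    exact ((isHomogeneous_X_pow 0 a).mul (isHomogeneous_X_pow 1 b)).mul (isHomogeneous_X_pow 2 c)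
  have h' (a b c : ℕ) (habc : a + b + c = 6) (p : Poly)
      (hp : p = X 0 ^ a * X 1 ^ b * X 2 ^ c) : p.IsHomogeneous 6 := hp ▸ h a b c habc
  refine (((IsHomogeneous.C_mul ?_ _).add (IsHomogeneous.C_mul ?_ _)).add
    (IsHomogeneous.C_mul ?_ _)).add (IsHomogeneous.C_mul (h 2 2 2 rfl) _)
  · exact ((h' 6 0 0 rfl _ (by ring)).add (h' 0 6 0 rfl _ (by ring))).add
      (h' 0 0 6 rfl _ (by ring))
  · exact ((h' 4 2 0 rfl _ (by ring)).add (h' 0 4 2 rfl _ (by ring))).add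
      (h' 2 0 4 rfl _ (by ring))
  · exact ((h' 2 4 0 rfl _ (by ring)).add (h' 0 2 4 rfl _ (by ring))).add
      (h' 4 0 2 rfl _ (by ring))

theorem subst_matZ_sextic : subst matZ sextic = sextic := by
  simp only [sextic, map_add, map_mul, map_pow, subst_C, subst_X, Fin.sum_univ_three]
  simp [matZ]
  ring

theorem subst_matQ_sextic : subst matQ sextic = sextic := by
  have h : (C rho : Poly) ^ 2 = -1 - C rho := by
    rw [← map_pow, rho_sq]; simp
  have h0 : subst matQ (X 0) = X 0 := by
    simp [subst_X, Fin.sum_univ_three, matQ]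
  have h1 : subst matQ (X 1 ^ 2) = C rho * X 2 ^ 2 := by
    simp only [map_pow, subst_X, Fin.sum_univ_three, matQ]
    simp
    grind
  have h2 : subst matQ (X 2 ^ 2) = (-1 - C rho) * X 1 ^ 2 := by
    simp only [map_pow, subst_X, Fin.sum_univ_three, matQ]
    simp
    grind
  -- `Q` interchanges `x₂²` and `x₃²` up to a cube root of unity, and only even powers occur
  have hs : sextic = C 2 * (X 0 ^ 6 + (X 1 ^ 2) ^ 3 + (X 2 ^ 2) ^ 3)
    + C (-3 + 6 * tau - 9 * rho + 3 * tau * rho)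
      * (X 0 ^ 4 * X 1 ^ 2 + (X 1 ^ 2) ^ 2 * X 2 ^ 2 + (X 2 ^ 2) ^ 2 * X 0 ^ 2)
    + C (9 - 3 * tau + 6 * rho + 3 * tau * rho)
      * (X 0 ^ 2 * (X 1 ^ 2) ^ 2 + X 1 ^ 2 * (X 2 ^ 2) ^ 2 + X 2 ^ 2 * X 0 ^ 4)
    + C (36 - 12 * tau + 12 * rho - 24 * tau * rho) * (X 0 ^ 2 * X 1 ^ 2 * X 2 ^ 2) := by
    rw [sextic]; ring
  rw [hs]
  simp only [map_add, map_mul, map_sub, map_pow (subst matQ) (_ ^ 2 : Poly), h1, h2, subst_C]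
  simp only [map_pow, h0]
  simp only [map_neg, map_ofNat]
  grind

theorem subst_matP_sextic : subst matP sextic = sextic := by
  have h : (C tau : Poly) ^ 2 = C tau + 1 := by
    rw [← map_pow, tau_sq]; simp
  have hh : (C 2⁻¹ : Poly) * 2 = 1 := by
    rw [← map_ofNat (C : ℂ →+* Poly) 2, ← map_mul]; norm_num
  have h0 : subst matP (X 0) = C 2⁻¹ * (X 0 + (C tau - 1) * X 1 - C tau * X 2) := by
    simp [subst_X, Fin.sum_univ_three, matP, tau_inv]; ring
  have h1 : subst matP (X 1) = C 2⁻¹ * ((C tau - 1) * X 0 + C tau * X 1 + X 2) := by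
    simp [subst_X, Fin.sum_univ_three, matP, tau_inv]; ring
  have h2 : subst matP (X 2) = C 2⁻¹ * (C tau * X 0 - X 1 + (C tau - 1) * X 2) := by
    simp [subst_X, Fin.sum_univ_three, matP, tau_inv]; ring
  -- the six linear forms orthogonal to the fivefold axes are permuted up to sign
  have e1 : subst matP (C tau * X 1 - X 0) = X 1 + C tau * X 2 := by
    simp only [map_sub, map_mul, subst_C, h0, h1]; grind
  have e2 : subst matP (C tau * X 1 + X 0) = X 0 + C tau * X 1 := by
    simp only [map_add, map_mul, subst_C, h0, h1]; grind
  have e3 : subst matP (C tau * X 2 - X 1) = X 0 - C tau * X 1 := by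
    simp only [map_sub, map_mul, subst_C, h1, h2]; grind
  have e4 : subst matP (C tau * X 2 + X 1) = C tau * X 0 + X 2 := by
    simp only [map_add, map_mul, subst_C, h1, h2]; grind
  have e5 : subst matP (C tau * X 0 - X 2) = X 1 - C tau * X 2 := by
    simp only [map_sub, map_mul, subst_C, h0, h2]; grind
  have e6 : subst matP (C tau * X 0 + X 2) = C tau * X 0 - X 2 := by
    simp only [map_add, map_mul, subst_C, h0, h2]; grind
  have e7 : subst matP (X 0 ^ 2 + X 1 ^ 2 + X 2 ^ 2) = X 0 ^ 2 + X 1 ^ 2 + X 2 ^ 2 := by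
    simp only [map_add, map_pow, h0, h1, h2]; grind
  -- the sextic as a combination of the two icosahedral invariants
  have hs : sextic = C 2 * (X 0 ^ 2 + X 1 ^ 2 + X 2 ^ 2) ^ 3
      + C (-24 + 15 * tau - 21 * rho + 12 * tau * rho)
        * ((C tau * X 1 - X 0) * (C tau * X 1 + X 0) * (C tau * X 2 - X 1)
          * (C tau * X 2 + X 1) * (C tau * X 0 - X 2) * (C tau * X 0 + X 2)) := by
    simp only [sextic, map_add, map_sub, map_mul, map_neg, map_ofNat]
    grind
  rw [hs, map_add, map_mul, map_mul, map_pow, e7, map_mul, map_mul, map_mul, map_mul, map_mul,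
    e1, e2, e3, e4, e5, e6, subst_C, subst_C]
  ring

theorem subst_sextic {T : GL (Fin 3) ℂ} (hT : T ∈ V2160) :
    subst (T : Matrix (Fin 3) (Fin 3) ℂ) sextic = sextic := by
  obtain ⟨c, W, hc, hW, hTW⟩ := exists_smul_of_mem_V2160 hT
  have hWs : subst (W : Matrix (Fin 3) (Fin 3) ℂ) sextic = sextic := by
    clear hTW
    induction hW using Subgroup.closure_induction with
    | mem g hg =>
      rcases hg with rfl | rfl | rfl
      exacts [subst_matZ_sextic, subst_matP_sextic, subst_matQ_sextic]
    | one => exact subst_one _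
    | mul a b _ _ ha hb => rw [Units.val_mul, ← subst_subst, ha, hb]
    | inv a _ ha =>
      conv_lhs => rw [← ha]
      rw [subst_subst, ← Units.val_mul, mul_inv_cancel, Units.val_one, subst_one]
  rw [hTW, subst_smul c _ isHomogeneous_sextic, hWs, hc, map_one, one_mul]

/-! ### Skew polynomials and the mirrors -/

/-- A polynomial is skew if it is invariant under `V1080` and odd; equivalently, it is
semi-invariant under `V2160` with respect to the determinant. -/
def IsSkew (f : Poly) : Prop :=
  (∀ T ∈ V1080, subst (T : Matrix (Fin 3) (Fin 3) ℂ) f = f) ∧ subst (-1) f = -f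

theorem mem_invariantRing_iff {f : Poly} : f ∈ invariantRing V2160 ↔
    (∀ T ∈ V1080, subst (T : Matrix (Fin 3) (Fin 3) ℂ) f = f) ∧ subst (-1) f = f := by
  constructor
  · intro hf
    have hf' (T : GL (Fin 3) ℂ) (hT : T ∈ V2160) :
        subst (T : Matrix (Fin 3) (Fin 3) ℂ) f = f := by
      simpa using hf T⁻¹ (inv_mem hT)
    refine ⟨fun T hT => hf' T (V1080_le_V2160 hT), ?_⟩
    simpa using hf' (-1) (neg_mem_V2160 (one_mem _))
  · rintro ⟨h1, h2⟩ T hT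
    rcases mem_V1080_or_neg_mem hT with h | h
    · exact h1 _ (inv_mem h)
    · have h3 := h1 _ (inv_mem h)
      conv_lhs => rw [← h2]
      rw [subst_subst]
      simpa using h3

/-- The linear form with coefficient vector `v`. -/
def linForm (v : Fin 3 → ℂ) : Poly := ∑ i, C (v i) * X i

theorem coeff_linForm (v : Fin 3 → ℂ) (i : Fin 3) :
    (linForm v).coeff (Finsupp.single i 1) = v i := by
  simp [linForm, coeff_sum, coeff_C_mul, coeff_X, Finsupp.single_left_inj]

theorem isHomogeneous_linForm (v : Fin 3 → ℂ) : (linForm v).IsHomogeneous 1 :=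
  IsHomogeneous.sum _ _ _ fun i _ => isHomogeneous_C_mul_X (v i) i

theorem linForm_ne_zero {v : Fin 3 → ℂ} (hv : v ≠ 0) : linForm v ≠ 0 := by
  intro h
  refine hv (funext fun i => ?_)
  rw [← coeff_linForm v i, h, coeff_zero, Pi.zero_apply]

theorem prime_linForm {v : Fin 3 → ℂ} (hv : v ≠ 0) : Prime (linForm v) := by
  refine Irreducible.prime (irreducible_of_totalDegree_eq_one
    ((isHomogeneous_linForm v).totalDegree (linForm_ne_zero hv)) fun x hx => ?_)
  obtain ⟨i, hi⟩ := Function.ne_iff.1 hv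
  have h := hx (Finsupp.single i 1)
  rw [coeff_linForm] at h
  exact isUnit_of_dvd_unit h (isUnit_iff_ne_zero.2 hi)

theorem parallel_of_linForm_dvd {v w : Fin 3 → ℂ} (hw : w ≠ 0) (h : linForm v ∣ linForm w)
    (i j : Fin 3) : v i * w j = w i * v j := by
  obtain ⟨q, hq⟩ := h
  have hw0 := linForm_ne_zero hw
  have hv0 : linForm v ≠ 0 := by rintro h0; simp [h0] at hq; exact hw0 hq
  have hq0 : q ≠ 0 := by rintro rfl; simp at hq; exact hw0 hq
  have hdeg := congrArg totalDegree hq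
  rw [totalDegree_mul_of_isDomain hv0 hq0, (isHomogeneous_linForm v).totalDegree hv0,
    (isHomogeneous_linForm w).totalDegree hw0] at hdeg
  obtain ⟨c, rfl⟩ : ∃ c, q = C c := ⟨_, totalDegree_eq_zero_iff_eq_C.1 (by omega)⟩
  have hc (k : Fin 3) : w k = v k * c := by
    rw [← coeff_linForm w, hq, mul_comm, coeff_C_mul, coeff_linForm, mul_comm]
  rw [hc i, hc j]
  ring

theorem subst_linForm (A : Matrix (Fin 3) (Fin 3) ℂ) (v : Fin 3 → ℂ) :
    subst A (linForm v) = linForm (v ᵥ* A) := by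
  simp only [linForm, map_sum, map_mul, subst_C, subst_X, vecMul, dotProduct, Finset.mul_sum,
    Finset.sum_mul, mul_assoc]
  exact Finset.sum_comm

theorem list_prod_primes_dvd {R : Type*} [CommRing R] {l : List R} {f : R}
    (hprime : ∀ a ∈ l, Prime a) (hl : l.Pairwise fun a b => ¬ b ∣ a) (hdvd : ∀ a ∈ l, a ∣ f) :
    l.prod ∣ f := by
  induction l generalizing f with
  | nil => simp
  | cons a l ih =>
    rw [List.pairwise_cons] at hl
    obtain ⟨k, rfl⟩ := hdvd a (by simp)
    rw [List.prod_cons]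
    refine mul_dvd_mul_left a (ih (fun b hb => hprime b (by simp [hb])) hl.2 fun b hb => ?_)
    exact ((hprime b (by simp [hb])).dvd_or_dvd (hdvd b (by simp [hb]))).resolve_left (hl.1 b hb)

theorem isHomogeneous_list_prod {ι : Type*} (l : List ι) (g : ι → Poly)
    (hg : ∀ i, (g i).IsHomogeneous 1) : (l.map g).prod.IsHomogeneous l.length := by
  induction l with
  | nil => simpa using isHomogeneous_one (Fin 3) ℂ
  | cons a l ih =>
    rw [List.map_cons, List.prod_cons, List.length_cons, add_comm]
    exact (hg a).mul ih

theorem coe_toGL (A : Matrix (Fin 3) (Fin 3) ℂ) (h : A.det = 1) :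
    (toGL A h : Matrix (Fin 3) (Fin 3) ℂ) = A := rfl

/-- A skew polynomial changes sign under the reflection `-Z`, so it vanishes on `x₂ = 0`. -/
theorem IsSkew.X_one_dvd {f : Poly} (hf : IsSkew f) : X 1 ∣ f := by
  -- modulo `x₂` the reflection `-Z` acts trivially
  have key (p : Poly) : (X 1 : Poly) ∣ subst (-matZ) p - p := by
    have hX (k : Fin 3) : (X 1 : Poly) ∣ subst (-matZ) (X k) - X k := by
      fin_cases k
      · simp [subst_X, Fin.sum_univ_three, matZ]
      · exact ⟨-2, by simp [subst_X, Fin.sum_univ_three, matZ]; ring⟩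
      · simp [subst_X, Fin.sum_univ_three, matZ]
    induction p using MvPolynomial.induction_on with
    | C a => simp
    | add p q hp hq =>
      rw [map_add, add_sub_add_comm]
      exact dvd_add hp hq
    | mul_X p k hp =>
      have h : subst (-matZ) (p * X k) - p * X k
          = (subst (-matZ) p - p) * X k + subst (-matZ) p * (subst (-matZ) (X k) - X k) := by
        rw [map_mul]; ring
      rw [h]
      exact dvd_add (Dvd.dvd.mul_right hp _) (Dvd.dvd.mul_left (hX k) _)
  have hZ : subst (-matZ) f = -f := by
    have h1 := hf.1 _ toGL_matZ_mem
    rw [coe_toGL] at h1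
    have h2 : subst (-1) (subst matZ f) = subst (-matZ) f := by
      rw [subst_subst]; simp
    rw [← h2, h1, hf.2]
  have h := key f
  rw [hZ] at h
  have h' : f = C (-1 / 2) * (-f - f) := by
    have : (-f - f : Poly) = C (-2) * f := by
      rw [map_neg, map_ofNat]; ring
    rw [this, ← mul_assoc, ← map_mul]
    norm_num
  rw [h']
  exact Dvd.dvd.mul_left h _

/-- The complex vector with the given coordinates. -/
def GEVector.toVec (v : GEVector) : Fin 3 → ℂ :=
  ![v.1.toComplex, v.2.1.toComplex, v.2.2.toComplex]

theorem GEVector.toVec_ne_zero {v : GEVector} (hv : v ≠ 0) : v.toVec ≠ 0 := by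
  intro h
  have h0 := toComplex_zero
  refine hv (Prod.ext (toComplex_injective ?_) (Prod.ext (toComplex_injective ?_)
    (toComplex_injective ?_)))
  · exact (congrFun h 0).trans h0.symm
  · exact (congrFun h 1).trans h0.symm
  · exact (congrFun h 2).trans h0.symm

theorem GEVector.toVec_mulP (v : GEVector) : v.mulP.toVec = (2 : ℂ) • (v.toVec ᵥ* matP) := by
  have hvec : v.toVec ᵥ* matP = fun j => ∑ i, v.toVec i * matP i j := rfl
  ext i
  rw [hvec]
  fin_cases i <;>
    simp [toVec, mulP, toComplex_add, toComplex_neg, toComplex_mul, Fin.sum_univ_three, matP,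
      tau_inv] <;> simp [toComplex] <;> ring

theorem GEVector.toVec_mulQ (v : GEVector) : v.mulQ.toVec = v.toVec ᵥ* matQ := by
  have h := rho_sq
  ext i
  fin_cases i <;>
    simp [toVec, mulQ, toComplex_mul, vecMul, dotProduct, Fin.sum_univ_three, matQ] <;>
    simp [toComplex] <;> grind

theorem linForm_smul (c : ℂ) (v : Fin 3 → ℂ) : linForm (c • v) = C c * linForm v := by
  simp [linForm, Finset.mul_sum, mul_assoc]

theorem IsSkew.mirror_dvd {f : Poly} (hf : IsSkew f) : ∀ v ∈ mirrors, linForm v.toVec ∣ f := by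
  refine mirrors_induction ?_ (fun v hv => ?_) fun v hv => ?_
  · have h : linForm (GEVector.toVec (0, ⟨1, 0, 0, 0⟩, 0)) = X 1 := by
      simp [linForm, GEVector.toVec, Fin.sum_univ_three, toComplex_zero]
      simp [toComplex]
    rw [h]
    exact hf.X_one_dvd
  · have h1 := hf.1 _ toGL_matP_mem
    rw [coe_toGL] at h1
    have h := map_dvd (subst matP) hv
    rw [h1, subst_linForm] at h
    rw [GEVector.toVec_mulP, linForm_smul]
    have h2 : IsUnit (C 2 : Poly) := (isUnit_iff_ne_zero.2 two_ne_zero).map C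
    exact h2.mul_left_dvd.2 h
  · have h1 := hf.1 _ toGL_matQ_mem
    rw [coe_toGL] at h1
    have h := map_dvd (subst matQ) hv
    rw [h1, subst_linForm] at h
    rwa [GEVector.toVec_mulQ]

/-- The product of the linear forms of all mirrors. -/
def mirrorProduct : Poly := (mirrors.map fun v => linForm v.toVec).prod

theorem isHomogeneous_mirrorProduct : mirrorProduct.IsHomogeneous 45 := by
  rw [← length_mirrors]
  exact isHomogeneous_list_prod _ _ fun v => isHomogeneous_linForm _

theorem IsSkew.mirrorProduct_dvd {f : Poly} (hf : IsSkew f) : mirrorProduct ∣ f := by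
  refine list_prod_primes_dvd ?_ ?_ ?_
  · intro a ha
    obtain ⟨v, hv, rfl⟩ := List.mem_map.1 ha
    exact prime_linForm (GEVector.toVec_ne_zero (ne_zero_of_mem_mirrors v hv))
  · rw [List.pairwise_map]
    refine pairwise_mirrors.imp_of_mem fun {v w} hv _ hvw hdvd => hvw ?_
    have h := parallel_of_linForm_dvd (GEVector.toVec_ne_zero (ne_zero_of_mem_mirrors v hv)) hdvd
    refine ⟨?_, ?_, ?_⟩ <;> apply toComplex_injective <;> rw [toComplex_mul, toComplex_mul]
    exacts [(h 0 1).symm, (h 0 2).symm, (h 1 2).symm]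
  · intro a ha
    obtain ⟨v, hv, rfl⟩ := List.mem_map.1 ha
    exact hf.mirror_dvd v hv

/-- A nonzero skew form of degree `45` is a multiple of the product of the mirrors, hence divides
every skew polynomial, and the quotient is invariant. -/
theorem IsSkew.exists_eq_mul {D f : Poly} (hD : IsSkew D) (hdeg : D.IsHomogeneous 45)
    (hD0 : D ≠ 0) (hf : IsSkew f) : ∃ g ∈ invariantRing V2160, f = g * D := by
  obtain ⟨q, hq⟩ := hD.mirrorProduct_dvd
  have hq0 : q ≠ 0 := by rintro rfl; simp at hq; exact hD0 hq
  have hL0 : mirrorProduct ≠ 0 := by rintro h; simp [h] at hq; exact hD0 hq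
  have h := congrArg totalDegree hq
  rw [totalDegree_mul_of_isDomain hL0 hq0, hdeg.totalDegree hD0,
    isHomogeneous_mirrorProduct.totalDegree hL0] at h
  obtain ⟨c, rfl⟩ : ∃ c, q = C c := ⟨_, totalDegree_eq_zero_iff_eq_C.1 (by omega)⟩
  have hc : c ≠ 0 := by rintro rfl; simp at hq0
  obtain ⟨k, hk⟩ := hf.mirrorProduct_dvd
  have hfg : f = (C c⁻¹ * k) * D := by
    have hC : (C c⁻¹ * C c : Poly) = 1 := by rw [← map_mul, inv_mul_cancel₀ hc, map_one]
    rw [hk, hq]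
    linear_combination (-mirrorProduct * k) * hC
  refine ⟨C c⁻¹ * k, mem_invariantRing_iff.2 ⟨fun T hT => ?_, ?_⟩, hfg⟩
  · apply mul_right_cancel₀ hD0
    rw [← hfg]
    conv_lhs => rw [← hD.1 T hT]
    rw [← map_mul, ← hfg, hf.1 T hT]
  · apply mul_right_cancel₀ (neg_ne_zero.2 hD0)
    conv_lhs => rw [← hD.2]
    rw [← map_mul, ← hfg, hf.2, mul_neg, ← hfg]

/-! ### The basic invariants and equivariant fields -/

/-- The invariant of degree 12: the Hessian determinant of the sextic. -/
def invariant12 : Poly := (hess sextic).det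

/-- The equivariant vector field of degree 19. -/
def field19 : Fin 3 → Poly := (hess sextic).adjugate *ᵥ grad invariant12

/-- The equivariant vector field of degree 25. -/
def field25 : Fin 3 → Poly := (hess invariant12).adjugate *ᵥ grad sextic

/-- The invariant of degree 30; up to sign, the bordered Hessian of the two smaller ones. -/
def invariant30 : Poly := grad invariant12 ⬝ᵥ field19

/-- The Jacobian determinant of the three basic invariants. -/
def jacobian : Poly :=
  grad sextic ⬝ᵥ crossProduct (grad invariant12) (grad invariant30)

/-- The determinant of the three basic equivariant vector fields, the first of which is the Euler
field `x ↦ x`. -/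
def fieldDet : Poly := X ⬝ᵥ crossProduct field19 field25

/-! ### Evaluation of the two determinants at a point -/

/-- Polynomial expressions in three variables over `ℤ[τ, ρ]`: sums and products of monomials,
left unexpanded. -/
inductive PolyExpr
  | mono (c : GoldenEisenstein) (i j k : ℕ)
  | add (p q : PolyExpr)
  | mul (p q : PolyExpr)

/-- Powers in `ℤ[τ, ρ]`. -/
def GoldenEisenstein.power (x : GoldenEisenstein) : ℕ → GoldenEisenstein
  | 0 => ⟨1, 0, 0, 0⟩
  | n + 1 => x * power x n

theorem GoldenEisenstein.toComplex_power (x : GoldenEisenstein) (n : ℕ) :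
    (x.power n).toComplex = x.toComplex ^ n := by
  induction n with
  | zero => simp [power, toComplex]
  | succ n ih => rw [power, toComplex_mul, ih, pow_succ']

namespace PolyExpr

instance : Add PolyExpr := ⟨add⟩

instance : Mul PolyExpr := ⟨mul⟩

instance : Neg PolyExpr := ⟨fun p => mono ⟨-1, 0, 0, 0⟩ 0 0 0 * p⟩

/-- The polynomial denoted by an expression. -/
def toPoly : PolyExpr → Poly
  | mono c i j k => C c.toComplex * (X 0 ^ i * X 1 ^ j * X 2 ^ k)
  | add p q => toPoly p + toPoly q
  | mul p q => toPoly p * toPoly q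

/-- The formal partial derivative of an expression. -/
def deriv (l : Fin 3) : PolyExpr → PolyExpr
  | mono c i j k => match l with
    | 0 => mono (⟨i, 0, 0, 0⟩ * c) (i - 1) j k
    | 1 => mono (⟨j, 0, 0, 0⟩ * c) i (j - 1) k
    | 2 => mono (⟨k, 0, 0, 0⟩ * c) i j (k - 1)
  | add p q => add (deriv l p) (deriv l q)
  | mul p q => add (mul (deriv l p) q) (mul p (deriv l q))

/-- The value of an expression at a point. -/
def value (x : Fin 3 → GoldenEisenstein) : PolyExpr → GoldenEisenstein
  | mono c i j k => c * (x 0).power i * (x 1).power j * (x 2).power k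
  | add p q => value x p + value x q
  | mul p q => value x p * value x q

theorem toPoly_add (p q : PolyExpr) : (p + q).toPoly = p.toPoly + q.toPoly := rfl

theorem toPoly_mul (p q : PolyExpr) : (p * q).toPoly = p.toPoly * q.toPoly := rfl

theorem toPoly_neg (p : PolyExpr) : (-p).toPoly = -p.toPoly := by
  change (mono ⟨-1, 0, 0, 0⟩ 0 0 0 * p).toPoly = _
  rw [toPoly_mul]
  simp [toPoly, toComplex]

theorem toPoly_deriv (l : Fin 3) (p : PolyExpr) : (p.deriv l).toPoly = pderiv l p.toPoly := by
  induction p with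
  | mono c i j k =>
    have h (n : ℕ) : toComplex (⟨n, 0, 0, 0⟩ * c) = n * c.toComplex := by
      rw [toComplex_mul]; simp [toComplex]
    fin_cases l <;> simp [deriv, toPoly, h, pderiv_X] <;> ring
  | add p q hp hq => simp [deriv, toPoly, hp, hq]
  | mul p q hp hq => simp [deriv, toPoly, hp, hq]; ring

theorem eval_toPoly (x : Fin 3 → GoldenEisenstein) (p : PolyExpr) :
    MvPolynomial.eval (fun i => (x i).toComplex) p.toPoly = (p.value x).toComplex := by
  induction p with
  | mono c i j k => simp [toPoly, value, toComplex_mul, toComplex_power, mul_assoc]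
  | add p q hp hq => simp [toPoly, value, hp, hq, toComplex_add]
  | mul p q hp hq => simp [toPoly, value, hp, hq, toComplex_mul]

theorem toPoly_ne_zero {p : PolyExpr} (x : Fin 3 → GoldenEisenstein) (h : p.value x ≠ 0) :
    p.toPoly ≠ 0 := by
  intro h0
  have h1 := eval_toPoly x p
  rw [h0, map_zero, ← toComplex_zero] at h1
  exact h (toComplex_injective h1).symm

/-- The expression for the three coordinates. -/
def coord : Fin 3 → PolyExpr :=
  ![mono ⟨1, 0, 0, 0⟩ 1 0 0, mono ⟨1, 0, 0, 0⟩ 0 1 0, mono ⟨1, 0, 0, 0⟩ 0 0 1]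

/-- The expression for the gradient. -/
def gradE (p : PolyExpr) (i : Fin 3) : PolyExpr := p.deriv i

/-- The expression for the Hessian matrix. -/
def hessE (p : PolyExpr) (i j : Fin 3) : PolyExpr := (p.deriv j).deriv i

/-- The expression for the scalar product. -/
def dotE (u v : Fin 3 → PolyExpr) : PolyExpr := u 0 * v 0 + u 1 * v 1 + u 2 * v 2

/-- The expression for the cross product. -/
def crossE (u v : Fin 3 → PolyExpr) : Fin 3 → PolyExpr :=
  ![u 1 * v 2 + -(u 2 * v 1), u 2 * v 0 + -(u 0 * v 2), u 0 * v 1 + -(u 1 * v 0)]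

/-- The expression for the determinant. -/
def detE (M : Fin 3 → Fin 3 → PolyExpr) : PolyExpr := dotE (M 0) (crossE (M 1) (M 2))

/-- The expression for the product of the adjugate of a matrix with a vector. -/
def adjMulVecE (M : Fin 3 → Fin 3 → PolyExpr) (v : Fin 3 → PolyExpr) (i : Fin 3) : PolyExpr :=
  dotE ![crossE (M 1) (M 2) i, crossE (M 2) (M 0) i, crossE (M 0) (M 1) i] v

theorem toPoly_coord : toPoly ∘ coord = X := by
  ext1 i
  fin_cases i <;> simp [coord, toPoly, toComplex]

theorem toPoly_gradE (p : PolyExpr) : toPoly ∘ gradE p = grad p.toPoly := by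
  ext1 i
  simp [gradE, grad, toPoly_deriv]

theorem toPoly_hessE (p : PolyExpr) (i j : Fin 3) :
    (hessE p i j).toPoly = hess p.toPoly i j := by
  simp [hessE, hess, toPoly_deriv]

theorem toPoly_dotE (u v : Fin 3 → PolyExpr) :
    (dotE u v).toPoly = (toPoly ∘ u) ⬝ᵥ (toPoly ∘ v) := by
  simp [dotE, toPoly_add, toPoly_mul, dotProduct, Fin.sum_univ_three]

theorem toPoly_crossE (u v : Fin 3 → PolyExpr) :
    toPoly ∘ crossE u v = crossProduct (toPoly ∘ u) (toPoly ∘ v) := by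
  ext1 i
  fin_cases i <;> simp [crossE, toPoly_add, toPoly_mul, toPoly_neg, cross_apply, sub_eq_add_neg]

theorem toPoly_detE {M : Fin 3 → Fin 3 → PolyExpr} {N : Matrix (Fin 3) (Fin 3) Poly}
    (h : ∀ i j, (M i j).toPoly = N i j) : (detE M).toPoly = N.det := by
  simp [detE, dotE, crossE, toPoly_add, toPoly_mul, toPoly_neg, h, det_fin_three]
  ring

theorem toPoly_adjMulVecE {M : Fin 3 → Fin 3 → PolyExpr} {N : Matrix (Fin 3) (Fin 3) Poly}
    (h : ∀ i j, (M i j).toPoly = N i j) (v : Fin 3 → PolyExpr) :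
    toPoly ∘ adjMulVecE M v = N.adjugate *ᵥ (toPoly ∘ v) := by
  ext1 i
  fin_cases i <;>
    simp [adjMulVecE, dotE, crossE, toPoly_add, toPoly_mul, toPoly_neg, h, mulVec, dotProduct,
      Fin.sum_univ_three, adjugate_fin_three] <;> ring

/-- The expression for the sextic. -/
def sexticE : PolyExpr :=
  mono ⟨2, 0, 0, 0⟩ 6 0 0 + mono ⟨2, 0, 0, 0⟩ 0 6 0 + mono ⟨2, 0, 0, 0⟩ 0 0 6
    + mono ⟨-3, 6, -9, 3⟩ 4 2 0 + mono ⟨-3, 6, -9, 3⟩ 0 4 2 + mono ⟨-3, 6, -9, 3⟩ 2 0 4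
    + mono ⟨9, -3, 6, 3⟩ 2 4 0 + mono ⟨9, -3, 6, 3⟩ 0 2 4 + mono ⟨9, -3, 6, 3⟩ 4 0 2
    + mono ⟨36, -12, 12, -24⟩ 2 2 2

/-- The expression for the invariant of degree 12. -/
def invariant12E : PolyExpr := detE (hessE sexticE)

/-- The expression for the vector field of degree 19. -/
def field19E : Fin 3 → PolyExpr := adjMulVecE (hessE sexticE) (gradE invariant12E)

/-- The expression for the vector field of degree 25. -/
def field25E : Fin 3 → PolyExpr := adjMulVecE (hessE invariant12E) (gradE sexticE)

/-- The expression for the invariant of degree 30. -/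
def invariant30E : PolyExpr := dotE (gradE invariant12E) field19E

/-- The expression for the Jacobian determinant. -/
def jacobianE : PolyExpr :=
  dotE (gradE sexticE) (crossE (gradE invariant12E) (gradE invariant30E))

/-- The expression for the determinant of the vector fields. -/
def fieldDetE : PolyExpr := dotE coord (crossE field19E field25E)

theorem toPoly_sexticE : sexticE.toPoly = sextic := by
  simp only [sexticE, toPoly_add, toPoly, toComplex, sextic]
  simp
  ring

theorem toPoly_invariant12E : invariant12E.toPoly = invariant12 :=
  toPoly_detE fun i j => by rw [toPoly_hessE, toPoly_sexticE]

theorem toPoly_field19E : toPoly ∘ field19E = field19 := by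
  rw [field19E, toPoly_adjMulVecE (N := hess sextic)
    (fun i j => by rw [toPoly_hessE, toPoly_sexticE]), toPoly_gradE, toPoly_invariant12E, field19]

theorem toPoly_field25E : toPoly ∘ field25E = field25 := by
  rw [field25E, toPoly_adjMulVecE (N := hess invariant12)
    (fun i j => by rw [toPoly_hessE, toPoly_invariant12E]), toPoly_gradE, toPoly_sexticE, field25]

theorem toPoly_invariant30E : invariant30E.toPoly = invariant30 := by
  rw [invariant30E, toPoly_dotE, toPoly_gradE, toPoly_invariant12E, toPoly_field19E, invariant30]

theorem toPoly_jacobianE : jacobianE.toPoly = jacobian := by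
  rw [jacobianE, toPoly_dotE, toPoly_crossE, toPoly_gradE, toPoly_gradE, toPoly_gradE,
    toPoly_sexticE, toPoly_invariant12E, toPoly_invariant30E, jacobian]

theorem toPoly_fieldDetE : fieldDetE.toPoly = fieldDet := by
  rw [fieldDetE, toPoly_dotE, toPoly_crossE, toPoly_coord, toPoly_field19E, toPoly_field25E,
    fieldDet]

/-- The point `(1, 1, 2)`, which lies on no mirror. -/
def basePoint : Fin 3 → GoldenEisenstein := ![⟨1, 0, 0, 0⟩, ⟨1, 0, 0, 0⟩, ⟨2, 0, 0, 0⟩]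

theorem value_jacobianE_ne_zero : jacobianE.value basePoint ≠ 0 := by decide +kernel

theorem value_fieldDetE_ne_zero : fieldDetE.value basePoint ≠ 0 := by decide +kernel

end PolyExpr

theorem jacobian_ne_zero : jacobian ≠ 0 :=
  PolyExpr.toPoly_jacobianE ▸ PolyExpr.toPoly_ne_zero _ PolyExpr.value_jacobianE_ne_zero

theorem fieldDet_ne_zero : fieldDet ≠ 0 :=
  PolyExpr.toPoly_fieldDetE ▸ PolyExpr.toPoly_ne_zero _ PolyExpr.value_fieldDetE_ne_zero

/-! ### Degrees and invariance of the basic objects -/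

/-- All components of a field are homogeneous of degree `n`. -/
def IsHomField (f : Fin 3 → Poly) (n : ℕ) : Prop := ∀ i, (f i).IsHomogeneous n

theorem isHomField_X : IsHomField X 1 := fun i => isHomogeneous_X ℂ i

theorem isHomField_grad {f : Poly} {n : ℕ} (hf : f.IsHomogeneous n) :
    IsHomField (grad f) (n - 1) := fun _ => hf.pderiv

theorem isHomField_hess {f : Poly} {n : ℕ} (hf : f.IsHomogeneous n) (i : Fin 3) :
    IsHomField (hess f i) (n - 1 - 1) := fun _ => hf.pderiv.pderiv

theorem IsHomField.dotProduct {f g : Fin 3 → Poly} {m n : ℕ} (hf : IsHomField f m)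
    (hg : IsHomField g n) : (f ⬝ᵥ g).IsHomogeneous (m + n) :=
  IsHomogeneous.sum _ _ _ fun i _ => (hf i).mul (hg i)

theorem IsHomField.cross {f g : Fin 3 → Poly} {m n : ℕ} (hf : IsHomField f m)
    (hg : IsHomField g n) : IsHomField (crossProduct f g) (m + n) := by
  intro i
  fin_cases i <;> exact ((hf _).mul (hg _)).sub ((hf _).mul (hg _))

theorem isHomogeneous_det {M : Matrix (Fin 3) (Fin 3) Poly} {k : ℕ} (hM : ∀ i, IsHomField (M i) k) :
    M.det.IsHomogeneous (3 * k) := by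
  rw [det_apply']
  refine IsHomogeneous.sum _ _ _ fun σ _ => ?_
  have h := IsHomogeneous.prod Finset.univ (fun i => M (σ i) i) (fun _ => k)
    fun i _ => hM (σ i) i
  rw [Finset.sum_const, Finset.card_univ, Fintype.card_fin, smul_eq_mul] at h
  have h' := h.C_mul ((Equiv.Perm.sign σ : ℤ) : ℂ)
  rwa [map_intCast] at h'

theorem isHomogeneous_adjugate {M : Matrix (Fin 3) (Fin 3) Poly} {k : ℕ}
    (hM : ∀ i, IsHomField (M i) k) (i : Fin 3) : IsHomField (M.adjugate i) (k + k) := by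
  have h (a b c d : Fin 3) : (M a b * M c d).IsHomogeneous (k + k) := (hM a b).mul (hM c d)
  have hM' := adjugate_fin_three M
  generalize M.adjugate = N at hM' ⊢
  subst hM'
  intro j
  fin_cases i <;> fin_cases j
  · exact (h 1 1 2 2).sub (h 1 2 2 1)
  · exact (h 0 1 2 2).neg.add (h 0 2 2 1)
  · exact (h 0 1 1 2).sub (h 0 2 1 1)
  · exact (h 1 0 2 2).neg.add (h 1 2 2 0)
  · exact (h 0 0 2 2).sub (h 0 2 2 0)
  · exact (h 0 0 1 2).neg.add (h 0 2 1 0)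
  · exact (h 1 0 2 1).sub (h 1 1 2 0)
  · exact (h 0 0 2 1).neg.add (h 0 1 2 0)
  · exact (h 0 0 1 1).sub (h 0 1 1 0)

theorem isHomField_adjugate_mulVec {M : Matrix (Fin 3) (Fin 3) Poly} {k n : ℕ}
    (hM : ∀ i, IsHomField (M i) k) {w : Fin 3 → Poly} (hw : IsHomField w n) :
    IsHomField (M.adjugate *ᵥ w) (k + k + n) :=
  fun i => (isHomogeneous_adjugate hM i).dotProduct hw

theorem isHomogeneous_invariant12 : invariant12.IsHomogeneous 12 :=
  isHomogeneous_det (isHomField_hess isHomogeneous_sextic)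

theorem isHomField_field19 : IsHomField field19 19 :=
  isHomField_adjugate_mulVec (isHomField_hess isHomogeneous_sextic)
    (isHomField_grad isHomogeneous_invariant12)

theorem isHomField_field25 : IsHomField field25 25 :=
  isHomField_adjugate_mulVec (isHomField_hess isHomogeneous_invariant12)
    (isHomField_grad isHomogeneous_sextic)

theorem isHomogeneous_invariant30 : invariant30.IsHomogeneous 30 :=
  (isHomField_grad isHomogeneous_invariant12).dotProduct isHomField_field19

theorem isHomogeneous_jacobian : jacobian.IsHomogeneous 45 :=
  (isHomField_grad isHomogeneous_sextic).dotProduct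
    ((isHomField_grad isHomogeneous_invariant12).cross (isHomField_grad isHomogeneous_invariant30))

theorem isHomogeneous_fieldDet : fieldDet.IsHomogeneous 45 :=
  isHomField_X.dotProduct (isHomField_field19.cross isHomField_field25)

theorem subst_neg_one {f : Poly} {n : ℕ} (hf : f.IsHomogeneous n) :
    subst (-1) f = C ((-1) ^ n) * f := by
  rw [← subst_smul_one _ hf, neg_one_smul]

theorem subst_neg_one_comp_of_odd {f : Fin 3 → Poly} {n : ℕ} (hf : IsHomField f n)
    (hn : Odd n) : subst (-1) ∘ f = -f := by
  ext1 i
  simp [subst_neg_one (hf i), hn.neg_one_pow]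

theorem subst_invariant12 {T : GL (Fin 3) ℂ} (hT : T ∈ V1080) :
    subst (T : Matrix (Fin 3) (Fin 3) ℂ) invariant12 = invariant12 :=
  subst_det_hess hT.2.1 (subst_sextic (V1080_le_V2160 hT))

theorem isVec_field19 {T : GL (Fin 3) ℂ} (hT : T ∈ V1080) :
    IsVec (T : Matrix (Fin 3) (Fin 3) ℂ) field19 :=
  (isCov_grad (subst_invariant12 hT)).adjugate_hess_mulVec hT.2.1
    (subst_sextic (V1080_le_V2160 hT))

theorem isVec_field25 {T : GL (Fin 3) ℂ} (hT : T ∈ V1080) :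
    IsVec (T : Matrix (Fin 3) (Fin 3) ℂ) field25 :=
  (isCov_grad (subst_sextic (V1080_le_V2160 hT))).adjugate_hess_mulVec hT.2.1
    (subst_invariant12 hT)

theorem subst_invariant30 {T : GL (Fin 3) ℂ} (hT : T ∈ V1080) :
    subst (T : Matrix (Fin 3) (Fin 3) ℂ) invariant30 = invariant30 :=
  (isCov_grad (subst_invariant12 hT)).dotProduct (isVec_field19 hT)

/-! ### Invariant modules over the ring of invariants -/

/-- The ring of `V2160`-invariant polynomials. -/
abbrev InvRing : Subalgebra ℂ Poly := invariantRing V2160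

theorem subst_coe_invRing (g : InvRing) {T : GL (Fin 3) ℂ} (hT : T ∈ V1080) :
    subst (T : Matrix (Fin 3) (Fin 3) ℂ) g = g :=
  (mem_invariantRing_iff.1 g.2).1 T hT

theorem subst_neg_one_coe_invRing (g : InvRing) : subst (-1) (g : Poly) = g :=
  (mem_invariantRing_iff.1 g.2).2

theorem subst_comp_smul (g : InvRing) {A : Matrix (Fin 3) (Fin 3) ℂ} (hg : subst A g = g)
    (f : Fin 3 → Poly) : subst A ∘ (g • f) = (g : Poly) • (subst A ∘ f) := by
  ext1 i
  change subst A ((g : Poly) * f i) = g * subst A (f i)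
  rw [map_mul, hg]

theorem subst_comp_add (A : Matrix (Fin 3) (Fin 3) ℂ) (f g : Fin 3 → Poly) :
    subst A ∘ (f + g) = subst A ∘ f + subst A ∘ g := by
  ext1 i
  simp

/-- The `V1080`-invariant polynomials as a module over the `V2160`-invariant ones. -/
def scalarModule : Submodule InvRing Poly where
  carrier := {f | ∀ T ∈ V1080, subst (T : Matrix (Fin 3) (Fin 3) ℂ) f = f}
  zero_mem' := fun T _ => map_zero _
  add_mem' := fun ha hb T hT => by rw [map_add, ha T hT, hb T hT]
  smul_mem' := fun g a ha T hT => by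
    rw [Subalgebra.smul_def, smul_eq_mul, map_mul, ha T hT, subst_coe_invRing g hT]

/-- The module of `V1080`-equivariant vector fields. -/
def vecModule : Submodule InvRing (Fin 3 → Poly) where
  carrier := {f | ∀ T ∈ V1080, IsVec (T : Matrix (Fin 3) (Fin 3) ℂ) f}
  zero_mem' := fun T _ => by
    rw [IsVec, mulVec_zero]
    ext1 i
    simp
  add_mem' := fun ha hb T hT => by
    rw [IsVec, subst_comp_add, ha T hT, hb T hT, mulVec_add]
  smul_mem' := fun g a ha T hT => by
    rw [IsVec, subst_comp_smul g (subst_coe_invRing g hT), ha T hT, ← mulVec_smul]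
    rfl

/-- The module of `V1080`-invariant covector fields, that is, differential 1-forms. -/
def covModule : Submodule InvRing (Fin 3 → Poly) where
  carrier := {f | ∀ T ∈ V1080, IsCov (T : Matrix (Fin 3) (Fin 3) ℂ) f}
  zero_mem' := fun T _ => by
    have h : subst (T : Matrix (Fin 3) (Fin 3) ℂ) ∘ (0 : Fin 3 → Poly) = 0 := by
      ext1 i
      simp
    rw [IsCov, h, zero_vecMul]
  add_mem' := fun ha hb T hT => by
    rw [IsCov, subst_comp_add, add_vecMul, ha T hT, hb T hT]
  smul_mem' := fun g a ha T hT => by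
    rw [IsCov, subst_comp_smul g (subst_coe_invRing g hT), smul_vecMul, ha T hT]
    rfl

theorem subst_comm_neg_one (A : Matrix (Fin 3) (Fin 3) ℂ) (f : Poly) :
    subst A (subst (-1) f) = subst (-1) (subst A f) := by
  rw [subst_subst, subst_subst]
  simp

theorem IsVec.subst_neg_one_comp {A : Matrix (Fin 3) (Fin 3) ℂ} {f : Fin 3 → Poly}
    (hf : IsVec A f) : IsVec A (subst (-1) ∘ f) := by
  ext1 i
  have h := congrArg (subst (-1)) (congrFun hf i)
  simp only [Function.comp_apply, mulVec, dotProduct, map_sum, map_mul, map_apply, subst_C] at h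
  rw [Function.comp_apply, Function.comp_apply, subst_comm_neg_one, h]
  rfl

theorem IsCov.subst_neg_one_comp {A : Matrix (Fin 3) (Fin 3) ℂ} {f : Fin 3 → Poly}
    (hf : IsCov A f) : IsCov A (subst (-1) ∘ f) := by
  ext1 i
  have h0 : ∑ j, subst A (f j) * C (A j i) = f i := congrFun hf i
  have h := congrArg (subst (-1)) h0
  simp only [map_sum, map_mul, subst_C, ← subst_comm_neg_one A] at h
  exact h

theorem isSkew_of_odd_of_even {u v : Fin 3 → Poly}
    (h : ∀ T ∈ V1080, subst (T : Matrix (Fin 3) (Fin 3) ℂ) (u ⬝ᵥ v) = u ⬝ᵥ v)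
    (hu : subst (-1) ∘ u = -u) (hv : subst (-1) ∘ v = v) : IsSkew (u ⬝ᵥ v) :=
  ⟨h, by rw [subst_dotProduct, hu, hv, neg_dotProduct]⟩

/-- Cramer's rule in dimension three. -/
theorem cramer_three {R : Type*} [CommRing R] (a b c m : Fin 3 → R) :
    (m ⬝ᵥ crossProduct b c) • a + (m ⬝ᵥ crossProduct c a) • b + (m ⬝ᵥ crossProduct a b) • c
      = (a ⬝ᵥ crossProduct b c) • m := by
  ext1 i
  fin_cases i <;> simp [cross_apply, dotProduct, Fin.sum_univ_three] <;> ring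

/-- Cramer's rule in dimension three for the dual basis. -/
theorem cramer_three_dual {R : Type*} [CommRing R] (a b c m : Fin 3 → R) :
    (m ⬝ᵥ a) • crossProduct b c + (m ⬝ᵥ b) • crossProduct c a + (m ⬝ᵥ c) • crossProduct a b
      = (a ⬝ᵥ crossProduct b c) • m := by
  ext1 i
  fin_cases i <;> simp [cross_apply, dotProduct, Fin.sum_univ_three] <;> ring

theorem eq_zero_of_combination {R : Type*} [CommRing R] [IsDomain R] {a b c : Fin 3 → R} {x y z : R}
    (h0 : a ⬝ᵥ crossProduct b c ≠ 0) (h : x • a + y • b + z • c = 0) : x = 0 ∧ y = 0 ∧ z = 0 := by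
  have hx : x * (a ⬝ᵥ crossProduct b c) = (x • a + y • b + z • c) ⬝ᵥ crossProduct b c := by
    simp [cross_apply, dotProduct, Fin.sum_univ_three]; ring
  have hy : y * (a ⬝ᵥ crossProduct b c) = (x • a + y • b + z • c) ⬝ᵥ crossProduct c a := by
    simp [cross_apply, dotProduct, Fin.sum_univ_three]; ring
  have hz : z * (a ⬝ᵥ crossProduct b c) = (x • a + y • b + z • c) ⬝ᵥ crossProduct a b := by
    simp [cross_apply, dotProduct, Fin.sum_univ_three]; ring
  rw [h, zero_dotProduct] at hx hy hz
  exact ⟨(mul_eq_zero.1 hx).resolve_right h0, (mul_eq_zero.1 hy).resolve_right h0,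
    (mul_eq_zero.1 hz).resolve_right h0⟩

theorem eq_zero_of_combination_dual {R : Type*} [CommRing R] [IsDomain R] {a b c : Fin 3 → R}
    {x y z : R} (h0 : a ⬝ᵥ crossProduct b c ≠ 0)
    (h : x • crossProduct b c + y • crossProduct c a + z • crossProduct a b = 0) :
    x = 0 ∧ y = 0 ∧ z = 0 := by
  have hx : x * (a ⬝ᵥ crossProduct b c)
      = a ⬝ᵥ (x • crossProduct b c + y • crossProduct c a + z • crossProduct a b) := by
    simp [cross_apply, dotProduct, Fin.sum_univ_three]; ring
  have hy : y * (a ⬝ᵥ crossProduct b c)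
      = b ⬝ᵥ (x • crossProduct b c + y • crossProduct c a + z • crossProduct a b) := by
    simp [cross_apply, dotProduct, Fin.sum_univ_three]; ring
  have hz : z * (a ⬝ᵥ crossProduct b c)
      = c ⬝ᵥ (x • crossProduct b c + y • crossProduct c a + z • crossProduct a b) := by
    simp [cross_apply, dotProduct, Fin.sum_univ_three]; ring
  rw [h, dotProduct_zero] at hx hy hz
  exact ⟨(mul_eq_zero.1 hx).resolve_right h0, (mul_eq_zero.1 hy).resolve_right h0,
    (mul_eq_zero.1 hz).resolve_right h0⟩

/-! ### Bases of the modules of invariant fields -/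

theorem subst_neg_one_comp_cross {u v : Fin 3 → Poly} (hu : subst (-1) ∘ u = -u)
    (hv : subst (-1) ∘ v = -v) :
    subst (-1) ∘ crossProduct u v = crossProduct u v := by
  rw [subst_cross, hu, hv]
  simp

/-- Cramer's rule writes an odd member of a module in terms of three odd members with skew
determinant of degree `45`; the coefficients are invariant because the numerators are skew. -/
theorem exists_combination_of_odd {N N' : Submodule InvRing (Fin 3 → Poly)}
    (hpair : ∀ f ∈ N, ∀ w ∈ N', ∀ T ∈ V1080,
      subst (T : Matrix (Fin 3) (Fin 3) ℂ) (f ⬝ᵥ w) = f ⬝ᵥ w)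
    (hcross : ∀ u ∈ N, ∀ v ∈ N, crossProduct u v ∈ N') {a b c f : Fin 3 → Poly}
    (ha : a ∈ N) (hb : b ∈ N) (hc : c ∈ N) (ha' : subst (-1) ∘ a = -a)
    (hb' : subst (-1) ∘ b = -b) (hc' : subst (-1) ∘ c = -c)
    (hdeg : (a ⬝ᵥ crossProduct b c).IsHomogeneous 45) (h0 : a ⬝ᵥ crossProduct b c ≠ 0)
    (hf : f ∈ N) (hf' : subst (-1) ∘ f = -f) :
    ∃ x y z : InvRing, f = x • a + y • b + z • c := by
  have hskew {u v w : Fin 3 → Poly} (hu : u ∈ N) (hv : v ∈ N) (hw : w ∈ N)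
      (hu' : subst (-1) ∘ u = -u) (hv' : subst (-1) ∘ v = -v) (hw' : subst (-1) ∘ w = -w) :
      IsSkew (u ⬝ᵥ crossProduct v w) :=
    isSkew_of_odd_of_even (hpair u hu _ (hcross v hv w hw)) hu' (subst_neg_one_comp_cross hv' hw')
  have hD := hskew ha hb hc ha' hb' hc'
  obtain ⟨x, hx, hx'⟩ := hD.exists_eq_mul hdeg h0 (hskew hf hb hc hf' hb' hc')
  obtain ⟨y, hy, hy'⟩ := hD.exists_eq_mul hdeg h0 (hskew hf hc ha hf' hc' ha')
  obtain ⟨z, hz, hz'⟩ := hD.exists_eq_mul hdeg h0 (hskew hf ha hb hf' ha' hb')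
  refine ⟨⟨x, hx⟩, ⟨y, hy⟩, ⟨z, hz⟩, ?_⟩
  have h := cramer_three a b c f
  rw [hx', hy', hz'] at h
  ext1 i
  apply mul_left_cancel₀ h0
  refine (congrFun h i).symm.trans ?_
  change x * _ * a i + y * _ * b i + z * _ * c i = _ * (x * a i + y * b i + z * c i)
  ring

/-- The dual form of `exists_combination_of_odd`: an even member is a combination of the cross
products of three odd members of the dual module. -/
theorem exists_combination_of_even {N N' : Submodule InvRing (Fin 3 → Poly)}
    (hpair : ∀ f ∈ N, ∀ w ∈ N', ∀ T ∈ V1080,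
      subst (T : Matrix (Fin 3) (Fin 3) ℂ) (f ⬝ᵥ w) = f ⬝ᵥ w)
    (hcross : ∀ u ∈ N', ∀ v ∈ N', crossProduct u v ∈ N) {a b c f : Fin 3 → Poly}
    (ha : a ∈ N') (hb : b ∈ N') (hc : c ∈ N') (ha' : subst (-1) ∘ a = -a)
    (hb' : subst (-1) ∘ b = -b) (hc' : subst (-1) ∘ c = -c)
    (hdeg : (a ⬝ᵥ crossProduct b c).IsHomogeneous 45) (h0 : a ⬝ᵥ crossProduct b c ≠ 0)
    (hf : f ∈ N) (hf' : subst (-1) ∘ f = f) :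
    ∃ x y z : InvRing,
      f = x • crossProduct b c + y • crossProduct c a + z • crossProduct a b := by
  have hskew {u v : Fin 3 → Poly} (hu : u ∈ N') (hv : v ∈ N) (hu' : subst (-1) ∘ u = -u)
      (hv' : subst (-1) ∘ v = v) : IsSkew (v ⬝ᵥ u) := by
    rw [dotProduct_comm]
    refine isSkew_of_odd_of_even (fun T hT => ?_) hu' hv'
    rw [dotProduct_comm]
    exact hpair v hv u hu T hT
  have hD : IsSkew (a ⬝ᵥ crossProduct b c) := by
    rw [dotProduct_comm]
    exact hskew ha (hcross b hb c hc) ha' (subst_neg_one_comp_cross hb' hc')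
  obtain ⟨x, hx, hx'⟩ := hD.exists_eq_mul hdeg h0 (hskew ha hf ha' hf')
  obtain ⟨y, hy, hy'⟩ := hD.exists_eq_mul hdeg h0 (hskew hb hf hb' hf')
  obtain ⟨z, hz, hz'⟩ := hD.exists_eq_mul hdeg h0 (hskew hc hf hc' hf')
  refine ⟨⟨x, hx⟩, ⟨y, hy⟩, ⟨z, hz⟩, ?_⟩
  have h := cramer_three_dual a b c f
  rw [hx', hy', hz'] at h
  ext1 i
  apply mul_left_cancel₀ h0
  refine (congrFun h i).symm.trans ?_
  change x * _ * _ + y * _ * _ + z * _ * _ = _ * (x * _ + y * _ + z * _)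
  ring

/-- Three odd members `a, b, c` of a module and the cross products of three odd members
`a', b', c'` of the dual module form a basis, provided that both determinants are nonzero of
degree `45`. -/
theorem isBasisOf_six {N N' : Submodule InvRing (Fin 3 → Poly)}
    (hpair : ∀ f ∈ N, ∀ w ∈ N', ∀ T ∈ V1080,
      subst (T : Matrix (Fin 3) (Fin 3) ℂ) (f ⬝ᵥ w) = f ⬝ᵥ w)
    (hneg : ∀ f ∈ N, subst (-1) ∘ f ∈ N)
    (hcross : ∀ u ∈ N, ∀ v ∈ N, crossProduct u v ∈ N')
    (hcross' : ∀ u ∈ N', ∀ v ∈ N', crossProduct u v ∈ N)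
    {a b c : Fin 3 → Poly} (ha : a ∈ N) (hb : b ∈ N) (hc : c ∈ N)
    (hao : subst (-1) ∘ a = -a) (hbo : subst (-1) ∘ b = -b) (hco : subst (-1) ∘ c = -c)
    (hdeg : (a ⬝ᵥ crossProduct b c).IsHomogeneous 45) (h0 : a ⬝ᵥ crossProduct b c ≠ 0)
    {a' b' c' : Fin 3 → Poly} (ha' : a' ∈ N') (hb' : b' ∈ N') (hc' : c' ∈ N')
    (hao' : subst (-1) ∘ a' = -a') (hbo' : subst (-1) ∘ b' = -b') (hco' : subst (-1) ∘ c' = -c')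
    (hdeg' : (a' ⬝ᵥ crossProduct b' c').IsHomogeneous 45)
    (h0' : a' ⬝ᵥ crossProduct b' c' ≠ 0) :
    IsBasisOf InvRing
      ![a, b, c, crossProduct b' c', crossProduct c' a', crossProduct a' b'] (N : Set _) := by
  constructor
  · rw [Fintype.linearIndependent_iff]
    intro g hg
    rw [Fin.sum_univ_six] at hg
    set odd : Fin 3 → Poly := (g 0 : Poly) • a + (g 1 : Poly) • b + (g 2 : Poly) • c with hodd
    set even : Fin 3 → Poly := (g 3 : Poly) • crossProduct b' c'
      + (g 4 : Poly) • crossProduct c' a' + (g 5 : Poly) • crossProduct a' b' with heven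
    have hsum : odd + even = 0 := by
      rw [← hg, hodd, heven]
      simp only [← add_assoc]
      rfl
    have hs (i : Fin 6) (f : Fin 3 → Poly) :
        subst (-1) ∘ ((g i : Poly) • f) = (g i : Poly) • (subst (-1) ∘ f) :=
      subst_comp_smul (g i) (subst_neg_one_coe_invRing (g i)) f
    have h1 : subst (-1) ∘ odd = -odd := by
      rw [hodd, subst_comp_add, subst_comp_add, hs, hs, hs, hao, hbo, hco]
      simp only [smul_neg, neg_add]
    have h2 : subst (-1) ∘ even = even := by
      rw [heven, subst_comp_add, subst_comp_add, hs, hs, hs, subst_neg_one_comp_cross hbo' hco',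
        subst_neg_one_comp_cross hco' hao', subst_neg_one_comp_cross hao' hbo']
    -- the substitution `x ↦ -x` separates the odd and the even part of a relation
    have h3 : -odd + even = 0 := by
      have h := subst_comp_add (-1) odd even
      rw [h1, h2, hsum] at h
      rw [← h]
      ext1 i
      simp
    have h4 : odd = 0 := by
      ext1 i
      have e1 := congrFun hsum i
      have e2 := congrFun h3 i
      simp only [Pi.add_apply, Pi.neg_apply, Pi.zero_apply] at e1 e2 ⊢
      have e3 : (2 : Poly) * odd i = 0 := by linear_combination e1 - e2
      exact (mul_eq_zero.1 e3).resolve_left two_ne_zero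
    have h5 : even = 0 := by rw [h4, zero_add] at hsum; exact hsum
    obtain ⟨i0, i1, i2⟩ := eq_zero_of_combination h0 h4
    obtain ⟨i3, i4, i5⟩ := eq_zero_of_combination_dual h0' h5
    intro i
    fin_cases i <;> exact Subtype.ext ‹_›
  · apply Set.Subset.antisymm
    · refine Submodule.span_le.2 ?_
      rintro _ ⟨i, rfl⟩
      fin_cases i
      exacts [ha, hb, hc, hcross' _ hb' _ hc', hcross' _ hc' _ ha', hcross' _ ha' _ hb']
    · intro f hf
      have hh : algebraMap ℂ InvRing (1 / 2) + algebraMap ℂ InvRing (1 / 2) = 1 := by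
        rw [← map_add, add_halves, map_one]
      have hinv : subst (-1) ∘ (subst (-1) ∘ f) = f := by
        ext1 i
        simp [subst_subst, subst_one]
      have hf' := hneg f hf
      have hnegs (u : Fin 3 → Poly) : subst (-1) ∘ (-u) = -(subst (-1) ∘ u) := by
        ext1 i
        simp
      obtain ⟨x, y, z, hxyz⟩ := exists_combination_of_odd hpair hcross ha hb hc hao hbo hco hdeg h0
        (N.sub_mem hf hf') (by rw [sub_eq_add_neg, subst_comp_add, hnegs, hinv]; abel)
      obtain ⟨x', y', z', hxyz'⟩ := exists_combination_of_even hpair hcross' ha' hb' hc' hao' hbo'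
        hco' hdeg' h0' (N.add_mem hf hf') (by rw [subst_comp_add, hinv, add_comm])
      have hsplit : f = algebraMap ℂ InvRing (1 / 2) • (f - subst (-1) ∘ f)
          + algebraMap ℂ InvRing (1 / 2) • (f + subst (-1) ∘ f) := by
        rw [← smul_add, sub_add_add_cancel, smul_add, ← add_smul, hh, one_smul]
      rw [hsplit, hxyz, hxyz']
      refine (Submodule.mem_span_range_iff_exists_fun InvRing).2
        ⟨algebraMap ℂ InvRing (1 / 2) • ![x, y, z, x', y', z'], ?_⟩
      rw [Fin.sum_univ_six]
      simp only [smul_add, ← mul_smul, ← add_assoc]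
      rfl

theorem isBasisOf_scalarModule {D : Poly} (hD : IsSkew D) (hdeg : D.IsHomogeneous 45)
    (h0 : D ≠ 0) : IsBasisOf InvRing ![1, D] (scalarModule : Set Poly) := by
  constructor
  · rw [Fintype.linearIndependent_iff]
    intro g hg
    rw [Fin.sum_univ_two] at hg
    have h1 : (g 0 : Poly) + g 1 * D = 0 := by
      rw [← hg]
      change _ = (g 0 : Poly) * 1 + g 1 * D
      rw [mul_one]
    have h2 : (g 0 : Poly) - g 1 * D = 0 := by
      have h := congrArg (subst (-1)) h1
      rw [map_add, map_mul, hD.2, subst_neg_one_coe_invRing, subst_neg_one_coe_invRing,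
        map_zero] at h
      linear_combination h
    have h3 : (2 : Poly) * g 0 = 0 := by linear_combination h1 + h2
    have h4 : (g 0 : Poly) = 0 := (mul_eq_zero.1 h3).resolve_left two_ne_zero
    rw [h4, zero_add] at h1
    have h5 : (g 1 : Poly) = 0 := (mul_eq_zero.1 h1).resolve_right h0
    intro i
    fin_cases i <;> exact Subtype.ext ‹_›
  · apply Set.Subset.antisymm
    · refine Submodule.span_le.2 ?_
      rintro _ ⟨i, rfl⟩
      fin_cases i
      exacts [fun T _ => map_one _, hD.1]
    · intro f hf
      have hinv : subst (-1) (subst (-1) f) = f := by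
        simp [subst_subst, subst_one]
      have hf' (T : GL (Fin 3) ℂ) (hT : T ∈ V1080) :
          subst (T : Matrix (Fin 3) (Fin 3) ℂ) (subst (-1) f) = subst (-1) f := by
        rw [subst_comm_neg_one, hf T hT]
      have hskew : IsSkew (C (1 / 2) * (f - subst (-1) f)) := by
        constructor
        · intro T hT
          rw [map_mul, map_sub, hf' T hT, hf T hT, subst_C]
        · rw [map_mul, map_sub, hinv, subst_C]
          ring
      obtain ⟨g, hg, hg'⟩ := hD.exists_eq_mul hdeg h0 hskew
      have he : C (1 / 2) * (f + subst (-1) f) ∈ invariantRing V2160 := by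
        refine mem_invariantRing_iff.2 ⟨fun T hT => ?_, ?_⟩
        · rw [map_mul, map_add, hf' T hT, hf T hT, subst_C]
        · rw [map_mul, map_add, hinv, subst_C, add_comm]
      refine (Submodule.mem_span_range_iff_exists_fun InvRing).2 ⟨![⟨_, he⟩, ⟨g, hg⟩], ?_⟩
      rw [Fin.sum_univ_two]
      change C (1 / 2) * (f + subst (-1) f) * 1 + g * D = f
      rw [← hg']
      have hh : (C (1 / 2) : Poly) + C (1 / 2) = 1 := by
        rw [← map_add, add_halves, map_one]
      linear_combination f * hh

theorem dotProduct_invariant_of_vec_of_cov {f w : Fin 3 → Poly} (hf : f ∈ vecModule)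
    (hw : w ∈ covModule) (T : GL (Fin 3) ℂ) (hT : T ∈ V1080) :
    subst (T : Matrix (Fin 3) (Fin 3) ℂ) (w ⬝ᵥ f) = w ⬝ᵥ f :=
  (hw T hT).dotProduct (hf T hT)

/-- A basis of the module of equivariant vector fields. -/
def vecBasis : Fin 6 → Fin 3 → Poly :=
  ![X, field19, field25, crossProduct (grad invariant12) (grad invariant30),
    crossProduct (grad invariant30) (grad sextic), crossProduct (grad sextic) (grad invariant12)]

/-- A basis of the module of invariant 1-forms. -/
def covBasis : Fin 6 → Fin 3 → Poly :=
  ![grad sextic, grad invariant12, grad invariant30, crossProduct field19 field25,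
    crossProduct field25 X, crossProduct X field19]

theorem cross_mem_covModule {u v : Fin 3 → Poly} (hu : u ∈ vecModule) (hv : v ∈ vecModule) :
    crossProduct u v ∈ covModule := fun T hT => (hu T hT).cross hT.2.1 (hv T hT)

theorem cross_mem_vecModule {u v : Fin 3 → Poly} (hu : u ∈ covModule) (hv : v ∈ covModule) :
    crossProduct u v ∈ vecModule := fun T hT => (hu T hT).cross hT.2.1 (hv T hT)

theorem X_mem_vecModule : (X : Fin 3 → Poly) ∈ vecModule := fun _ _ => isVec_X

theorem field19_mem_vecModule : field19 ∈ vecModule := fun _ hT => isVec_field19 hT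

theorem field25_mem_vecModule : field25 ∈ vecModule := fun _ hT => isVec_field25 hT

theorem grad_sextic_mem_covModule : grad sextic ∈ covModule :=
  fun _ hT => isCov_grad (subst_sextic (V1080_le_V2160 hT))

theorem grad_invariant12_mem_covModule : grad invariant12 ∈ covModule :=
  fun _ hT => isCov_grad (subst_invariant12 hT)

theorem grad_invariant30_mem_covModule : grad invariant30 ∈ covModule :=
  fun _ hT => isCov_grad (subst_invariant30 hT)

theorem odd_X : subst (-1) ∘ (X : Fin 3 → Poly) = -X :=
  subst_neg_one_comp_of_odd isHomField_X (by decide)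

theorem odd_field19 : subst (-1) ∘ field19 = -field19 :=
  subst_neg_one_comp_of_odd isHomField_field19 (by decide)

theorem odd_field25 : subst (-1) ∘ field25 = -field25 :=
  subst_neg_one_comp_of_odd isHomField_field25 (by decide)

theorem odd_grad_sextic : subst (-1) ∘ grad sextic = -grad sextic :=
  subst_neg_one_comp_of_odd (isHomField_grad isHomogeneous_sextic) (by decide)

theorem odd_grad_invariant12 : subst (-1) ∘ grad invariant12 = -grad invariant12 :=
  subst_neg_one_comp_of_odd (isHomField_grad isHomogeneous_invariant12) (by decide)

theorem odd_grad_invariant30 : subst (-1) ∘ grad invariant30 = -grad invariant30 :=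
  subst_neg_one_comp_of_odd (isHomField_grad isHomogeneous_invariant30) (by decide)

theorem isBasisOf_vecBasis : IsBasisOf InvRing vecBasis (vecModule : Set (Fin 3 → Poly)) :=
  isBasisOf_six (N := vecModule) (N' := covModule)
    (fun f hf w hw T hT => by
      rw [dotProduct_comm]; exact dotProduct_invariant_of_vec_of_cov hf hw T hT)
    (fun _ hf T hT => (hf T hT).subst_neg_one_comp)
    (fun _ hu _ hv => cross_mem_covModule hu hv) (fun _ hu _ hv => cross_mem_vecModule hu hv)
    X_mem_vecModule field19_mem_vecModule field25_mem_vecModule odd_X odd_field19 odd_field25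
    isHomogeneous_fieldDet fieldDet_ne_zero grad_sextic_mem_covModule
    grad_invariant12_mem_covModule grad_invariant30_mem_covModule odd_grad_sextic
    odd_grad_invariant12 odd_grad_invariant30 isHomogeneous_jacobian jacobian_ne_zero

theorem isBasisOf_covBasis : IsBasisOf InvRing covBasis (covModule : Set (Fin 3 → Poly)) :=
  isBasisOf_six (N := covModule) (N' := vecModule)
    (fun _ hw _ hf T hT => dotProduct_invariant_of_vec_of_cov hf hw T hT)
    (fun _ hf T hT => (hf T hT).subst_neg_one_comp)
    (fun _ hu _ hv => cross_mem_vecModule hu hv) (fun _ hu _ hv => cross_mem_covModule hu hv)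
    grad_sextic_mem_covModule grad_invariant12_mem_covModule grad_invariant30_mem_covModule
    odd_grad_sextic odd_grad_invariant12 odd_grad_invariant30 isHomogeneous_jacobian
    jacobian_ne_zero X_mem_vecModule field19_mem_vecModule field25_mem_vecModule odd_X odd_field19
    odd_field25 isHomogeneous_fieldDet fieldDet_ne_zero

theorem isSkew_jacobian : IsSkew jacobian :=
  isSkew_of_odd_of_even
    (fun T hT => dotProduct_invariant_of_vec_of_cov
      (cross_mem_vecModule grad_invariant12_mem_covModule grad_invariant30_mem_covModule)
      grad_sextic_mem_covModule T hT)
    odd_grad_sextic (subst_neg_one_comp_cross odd_grad_invariant12 odd_grad_invariant30)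

theorem isHomField_vecBasis (i : Fin 6) : IsHomField (vecBasis i) (![1, 19, 25, 40, 34, 16] i) := by
  have h1 := isHomField_grad isHomogeneous_sextic
  have h2 := isHomField_grad isHomogeneous_invariant12
  have h3 := isHomField_grad isHomogeneous_invariant30
  fin_cases i
  exacts [isHomField_X, isHomField_field19, isHomField_field25, h2.cross h3, h3.cross h1,
    h1.cross h2]

theorem isHomField_covBasis (i : Fin 6) : IsHomField (covBasis i) (![5, 11, 29, 44, 26, 20] i) := by
  fin_cases i
  exacts [isHomField_grad isHomogeneous_sextic, isHomField_grad isHomogeneous_invariant12,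
    isHomField_grad isHomogeneous_invariant30, isHomField_field19.cross isHomField_field25,
    isHomField_field25.cross isHomField_X, isHomField_X.cross isHomField_field19]

/-! ### Differential forms as polynomials and polynomial fields -/

theorem mem_invariantForms_iff {G : Subgroup (GL (Fin 3) ℂ)} {p : ℕ} {α : PolyForm p} :
    α ∈ invariantForms G p ↔ ∀ T ∈ G, pullback (T : Matrix (Fin 3) (Fin 3) ℂ) α = α := by
  constructor
  · intro h T hT
    simpa [act] using h T⁻¹ (inv_mem hT)
  · intro h T hT
    exact h T⁻¹ (inv_mem hT)

theorem pullback_apply (A : Matrix (Fin 3) (Fin 3) ℂ) {p : ℕ} (α : PolyForm p)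
    (v : Fin p → Fin 3 → ℂ) : pullback A α v = subst A (α fun i => A *ᵥ v i) := rfl

/-- A polynomial as a 0-form. -/
def zeroForm (f : Poly) : PolyForm 0 := AlternatingMap.constOfIsEmpty ℂ (Fin 3 → ℂ) (Fin 0) f

/-- The 1-form `w₁ dx₁ + w₂ dx₂ + w₃ dx₃`. -/
def oneForm (w : Fin 3 → Poly) : PolyForm 1 :=
  AlternatingMap.ofSubsingleton ℂ (Fin 3 → ℂ) Poly (0 : Fin 1) (Fintype.linearCombination ℂ w)

/-- The 3-form `f dx₁ ∧ dx₂ ∧ dx₃`. -/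
def threeForm (f : Poly) : PolyForm 3 :=
  (LinearMap.toSpanSingleton ℂ Poly f).compAlternatingMap Matrix.detRowAlternating

theorem oneForm_apply (w : Fin 3 → Poly) (v : Fin 1 → Fin 3 → ℂ) :
    oneForm w v = ∑ i, v 0 i • w i := rfl

theorem twoForm_apply (f : Fin 3 → Poly) (v : Fin 2 → Fin 3 → ℂ) :
    twoForm f v = ∑ i, (crossProduct (v 0) (v 1)) i • f i := rfl

theorem threeForm_apply (f : Poly) (v : Fin 3 → Fin 3 → ℂ) :
    threeForm f v = (Matrix.of v).det • f := rfl

theorem subst_smul_poly (A : Matrix (Fin 3) (Fin 3) ℂ) (c : ℂ) (f : Poly) :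
    subst A (c • f) = c • subst A f := map_smul _ _ _

theorem pullback_zeroForm (A : Matrix (Fin 3) (Fin 3) ℂ) (f : Poly) :
    pullback A (zeroForm f) = zeroForm (subst A f) := rfl

theorem pullback_oneForm (A : Matrix (Fin 3) (Fin 3) ℂ) (w : Fin 3 → Poly) :
    pullback A (oneForm w) = oneForm ((subst A ∘ w) ᵥ* constMatrix A) := by
  ext1 v
  simp only [pullback_apply, oneForm_apply, mulVec, vecMul, dotProduct, Fin.sum_univ_three,
    smul_eq_C_mul, map_add, map_mul, Function.comp_apply, map_apply, subst_C]
  ring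

theorem pullback_twoForm (A : Matrix (Fin 3) (Fin 3) ℂ) (f : Fin 3 → Poly) :
    pullback A (twoForm f) = twoForm ((constMatrix A).adjugate *ᵥ (subst A ∘ f)) := by
  ext1 v
  rw [pullback_apply, twoForm_apply, twoForm_apply, adjugate_fin_three]
  simp [mulVec, dotProduct, Fin.sum_univ_three, smul_eq_C_mul, cross_apply]
  ring

theorem pullback_threeForm (A : Matrix (Fin 3) (Fin 3) ℂ) (f : Poly) :
    pullback A (threeForm f) = threeForm (A.det • subst A f) := by
  ext1 v
  have h : Matrix.of (fun i => A *ᵥ v i) = Matrix.of v * Aᵀ := by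
    ext i j
    simp [mul_apply, mulVec, dotProduct, mul_comm]
  rw [pullback_apply, threeForm_apply, threeForm_apply, h, det_mul, det_transpose, subst_smul_poly,
    mul_smul]

theorem zeroForm_injective : Function.Injective zeroForm := fun _ _ h =>
  DFunLike.congr_fun h Fin.elim0

theorem oneForm_single (w : Fin 3 → Poly) (i : Fin 3) :
    oneForm w ![Pi.single i 1] = w i := by
  simp [oneForm_apply, Pi.single_apply]

theorem oneForm_injective : Function.Injective oneForm := fun f g h => by
  ext1 i
  rw [← oneForm_single f, h, oneForm_single]

theorem twoForm_single (f : Fin 3 → Poly) (i : Fin 3) :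
    twoForm f ![Pi.single (i + 1) 1, Pi.single (i + 2) 1] = f i := by
  rw [twoForm_apply, Fin.sum_univ_three]
  fin_cases i <;> simp [cross_apply]

theorem twoForm_injective : Function.Injective twoForm := fun f g h => by
  ext1 i
  rw [← twoForm_single f, h, twoForm_single]

theorem threeForm_single (f : Poly) : threeForm f (fun i => Pi.single i 1) = f := by
  have h : Matrix.of (fun i => Pi.single i 1) = (1 : Matrix (Fin 3) (Fin 3) ℂ) := by
    ext i j
    simp [Matrix.one_apply, Pi.single_apply, eq_comm]
  rw [threeForm_apply, h, det_one, one_smul]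

theorem threeForm_injective : Function.Injective threeForm := fun f g h => by
  rw [← threeForm_single f, h, threeForm_single]

theorem zeroForm_surjective : Function.Surjective zeroForm := fun α =>
  ⟨α Fin.elim0, AlternatingMap.ext fun _ => congrArg α (Subsingleton.elim _ _)⟩

theorem oneForm_surjective : Function.Surjective oneForm := fun α => by
  refine ⟨fun i => α ![Pi.single i 1], (Pi.basisFun ℂ (Fin 3)).ext_alternating fun v _ => ?_⟩
  have h : (fun i => Pi.basisFun ℂ (Fin 3) (v i)) = ![Pi.single (v 0) 1] := by
    ext1 i
    fin_cases i
    simp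
  rw [h, oneForm_single]

theorem twoForm_surjective : Function.Surjective twoForm := fun α => by
  refine ⟨fun i => α ![Pi.single (i + 1) 1, Pi.single (i + 2) 1],
    (Pi.basisFun ℂ (Fin 3)).ext_alternating fun v hv => ?_⟩
  have h : (fun i => Pi.basisFun ℂ (Fin 3) (v i)) = ![Pi.single (v 0) 1, Pi.single (v 1) 1] := by
    ext1 i
    fin_cases i <;> simp
  have hne : v 0 ≠ v 1 := fun h => absurd (hv h) (by decide)
  have hswap (β : PolyForm 2) (a b : Fin 3 → ℂ) : β ![a, b] = -β ![b, a] := by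
    have h := β.map_swap ![b, a] (show (0 : Fin 2) ≠ 1 by decide)
    rw [← h]
    congr 1
    ext1 i
    fin_cases i <;> rfl
  have hcase : ∀ i j : Fin 3, i ≠ j → ∃ k : Fin 3,
      (i = k + 1 ∧ j = k + 2) ∨ (i = k + 2 ∧ j = k + 1) := by decide
  rw [h]
  obtain ⟨k, ⟨hi, hj⟩ | ⟨hi, hj⟩⟩ := hcase _ _ hne
  · rw [hi, hj, twoForm_single]
  · rw [hi, hj, hswap, twoForm_single, hswap α, neg_neg]

theorem threeForm_surjective : Function.Surjective threeForm := fun α => by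
  refine ⟨α fun i => Pi.single i 1, (Pi.basisFun ℂ (Fin 3)).ext_alternating fun v hv => ?_⟩
  have h : (fun i => Pi.basisFun ℂ (Fin 3) (v i)) = (fun i : Fin 3 => Pi.single i (1 : ℂ))
      ∘ Equiv.ofBijective v hv.bijective_of_finite := by
    ext1 i
    simp
  rw [h, AlternatingMap.map_perm, AlternatingMap.map_perm, threeForm_single]

theorem zeroForm_mem_invariantForms {G : Subgroup (GL (Fin 3) ℂ)} {f : Poly} :
    zeroForm f ∈ invariantForms G 0 ↔ f ∈ invariantRing G := by
  constructor
  · intro h T hT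
    exact zeroForm_injective (h T hT)
  · intro h T hT
    exact congrArg zeroForm (h T hT)

theorem zeroForm_mem_iff {f : Poly} : zeroForm f ∈ invariantForms V1080 0 ↔ f ∈ scalarModule := by
  rw [mem_invariantForms_iff]
  refine forall₂_congr fun T hT => ?_
  rw [pullback_zeroForm, zeroForm_injective.eq_iff]

theorem oneForm_mem_iff {w : Fin 3 → Poly} :
    oneForm w ∈ invariantForms V1080 1 ↔ w ∈ covModule := by
  rw [mem_invariantForms_iff]
  refine forall₂_congr fun T hT => ?_
  rw [pullback_oneForm, oneForm_injective.eq_iff]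
  rfl

theorem twoForm_mem_iff {f : Fin 3 → Poly} :
    twoForm f ∈ invariantForms V1080 2 ↔ f ∈ vecModule := by
  rw [mem_invariantForms_iff]
  refine forall₂_congr fun T hT => ?_
  rw [pullback_twoForm, twoForm_injective.eq_iff]
  have hdet := det_constMatrix hT.2.1
  constructor
  · intro h
    rw [IsVec]
    conv_rhs => rw [← h]
    rw [mulVec_mulVec, mul_adjugate, hdet, one_smul, one_mulVec]
  · intro h
    rw [h, mulVec_mulVec, adjugate_mul, hdet, one_smul, one_mulVec]

theorem threeForm_mem_iff {f : Poly} :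
    threeForm f ∈ invariantForms V1080 3 ↔ f ∈ scalarModule := by
  rw [mem_invariantForms_iff]
  refine forall₂_congr fun T hT => ?_
  rw [pullback_threeForm, threeForm_injective.eq_iff, hT.2.1, one_smul]

theorem isEquivariant_iff {f : Fin 3 → Poly} : IsEquivariant V1080 f ↔ f ∈ vecModule := by
  refine forall₂_congr fun T hT => ?_
  rw [IsVec, funext_iff]
  refine forall_congr' fun i => ?_
  simp only [smul_eq_C_mul]
  rfl

/-- Polynomials and 0-forms are isomorphic modules over the ring of invariants. -/
def zeroFormEquiv : Poly ≃ₗ[InvRing] PolyForm 0 :=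
  LinearEquiv.ofBijective
    { toFun := zeroForm, map_add' := fun _ _ => rfl, map_smul' := fun _ _ => rfl }
    ⟨zeroForm_injective, zeroForm_surjective⟩

/-- Covector fields and 1-forms are isomorphic modules over the ring of invariants. -/
def oneFormEquiv : (Fin 3 → Poly) ≃ₗ[InvRing] PolyForm 1 :=
  LinearEquiv.ofBijective
    { toFun := oneForm
      map_add' := fun f g => by
        ext1 v
        simp [oneForm_apply, Finset.sum_add_distrib]
      map_smul' := fun c f => by
        ext1 v
        simp [oneForm_apply, Finset.smul_sum, smul_comm c] }
    ⟨oneForm_injective, oneForm_surjective⟩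

/-- Vector fields and 2-forms are isomorphic modules over the ring of invariants. -/
def twoFormEquiv : (Fin 3 → Poly) ≃ₗ[InvRing] PolyForm 2 :=
  LinearEquiv.ofBijective
    { toFun := twoForm
      map_add' := fun f g => by
        ext1 v
        simp [twoForm_apply, Finset.sum_add_distrib]
      map_smul' := fun c f => by
        ext1 v
        simp [twoForm_apply, Finset.smul_sum, smul_comm c] }
    ⟨twoForm_injective, twoForm_surjective⟩

/-- Polynomials and 3-forms are isomorphic modules over the ring of invariants. -/
def threeFormEquiv : Poly ≃ₗ[InvRing] PolyForm 3 :=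
  LinearEquiv.ofBijective
    { toFun := threeForm
      map_add' := fun f g => by
        ext1 v
        simp [threeForm_apply]
      map_smul' := fun c f => by
        ext1 v
        simp [threeForm_apply, smul_comm c] }
    ⟨threeForm_injective, threeForm_surjective⟩

/-- A linear equivalence carries a basis of a submodule to a basis of its image. -/
theorem IsBasisOf.map {R M M' ι : Type} [Ring R] [AddCommGroup M] [Module R M] [AddCommGroup M']
    [Module R M'] {b : ι → M} {N : Set M} {N' : Set M'} (hb : IsBasisOf R b N) (e : M ≃ₗ[R] M')
    (he : ∀ x, e x ∈ N' ↔ x ∈ N) : IsBasisOf R (fun i => e (b i)) N' := by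
  refine ⟨hb.1.map' e.toLinearMap e.ker, ?_⟩
  have h : Set.range (fun i => e (b i)) = e.toLinearMap '' Set.range b := by
    rw [← Set.range_comp]; rfl
  rw [h, Submodule.span_image, Submodule.map_coe, hb.2]
  ext y
  constructor
  · rintro ⟨x, hx, rfl⟩
    exact (he x).2 hx
  · intro hy
    exact ⟨e.symm y, (he _).1 (by simpa using hy), by simp⟩

theorem zeroForm_mem_homogeneousForms {f : Poly} {m : ℕ} :
    zeroForm f ∈ homogeneousForms 0 m ↔ f.IsHomogeneous m :=
  ⟨fun h => h Fin.elim0, fun h _ => h⟩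

theorem oneForm_mem_homogeneousForms {w : Fin 3 → Poly} {m : ℕ} (hw : IsHomField w m) :
    oneForm w ∈ homogeneousForms 1 m :=
  fun v => Submodule.sum_mem (homogeneousSubmodule (Fin 3) ℂ m)
    fun i _ => Submodule.smul_mem _ (v 0 i) (hw i)

theorem twoForm_mem_homogeneousForms {f : Fin 3 → Poly} {m : ℕ} (hf : IsHomField f m) :
    twoForm f ∈ homogeneousForms 2 m :=
  fun v => Submodule.sum_mem (homogeneousSubmodule (Fin 3) ℂ m)
    fun i _ => Submodule.smul_mem _ ((crossProduct (v 0) (v 1)) i) (hf i)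

theorem threeForm_mem_homogeneousForms {f : Poly} {m : ℕ} (hf : f.IsHomogeneous m) :
    threeForm f ∈ homogeneousForms 3 m :=
  fun _ => Submodule.smul_mem _ _ hf

/-! ### Molien series of free modules -/

theorem homogeneousComponent_mul_of_isHomogeneous {q : Poly} {d : ℕ} (hq : q.IsHomogeneous d)
    (m : ℕ) (p : Poly) : homogeneousComponent m (p * q)
      = if d ≤ m then homogeneousComponent (m - d) p * q else 0 := by
  have h (k : ℕ) : homogeneousComponent m (homogeneousComponent k p * q)
      = if k + d = m then homogeneousComponent k p * q else 0 := by
    rw [homogeneousComponent_of_mem ((homogeneousComponent_isHomogeneous k p).mul hq)]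
    simp only [eq_comm]
  conv_lhs => rw [← sum_homogeneousComponent p, Finset.sum_mul, map_sum]
  simp only [h]
  split_ifs with hd
  · have h' (k : ℕ) : (k + d = m) ↔ k = m - d := by omega
    simp only [h', Finset.sum_ite_eq', Finset.mem_range]
    split_ifs with hk
    · rfl
    · rw [homogeneousComponent_eq_zero _ _ (by omega), zero_mul]
  · exact Finset.sum_eq_zero fun k _ => if_neg (by omega)

/-- The invariant polynomials that are homogeneous of degree `k`. -/
def invDegree (k : ℕ) : Submodule ℂ Poly :=
  Subalgebra.toSubmodule InvRing ⊓ homogeneousSubmodule (Fin 3) ℂ k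

instance (k : ℕ) : FiniteDimensional ℂ (invDegree k) := by
  have : FiniteDimensional ℂ (homogeneousSubmodule (Fin 3) ℂ k) :=
    Module.Finite.iff_fg.2 (homogeneousSubmodule_fg _ _ k)
  exact Submodule.finiteDimensional_of_le
    (inf_le_right : invDegree k ≤ homogeneousSubmodule (Fin 3) ℂ k)

theorem homogeneousComponent_mem_invDegree (g : InvRing) (k : ℕ) :
    homogeneousComponent k (g : Poly) ∈ invDegree k := by
  refine ⟨fun T hT => ?_, homogeneousComponent_isHomogeneous k _⟩
  rw [← homogeneousComponent_subst, g.2 T hT]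

/-- The invariants that may occur in degree `m` as coefficients of a generator of degree `d`. -/
def coeffSpace (d m : ℕ) : Submodule ℂ Poly := if d ≤ m then invDegree (m - d) else ⊥

theorem coeffSpace_of_le {d m : ℕ} (h : d ≤ m) : coeffSpace d m = invDegree (m - d) := if_pos h

theorem coeffSpace_of_not_le {d m : ℕ} (h : ¬ d ≤ m) : coeffSpace d m = ⊥ := if_neg h

theorem coeffSpace_le (d m : ℕ) : coeffSpace d m ≤ Subalgebra.toSubmodule InvRing := by
  unfold coeffSpace
  split_ifs
  exacts [inf_le_left, bot_le]

instance (d m : ℕ) : FiniteDimensional ℂ (coeffSpace d m) := by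
  by_cases h : d ≤ m
  · rw [coeffSpace_of_le h]; infer_instance
  · rw [coeffSpace_of_not_le h]; infer_instance

theorem finrank_coeffSpace (d m : ℕ) :
    Module.finrank ℂ (coeffSpace d m)
      = if d ≤ m then Module.finrank ℂ (invDegree (m - d)) else 0 := by
  split_ifs with h
  · rw [coeffSpace_of_le h]
  · rw [coeffSpace_of_not_le h, finrank_bot]

theorem homogeneousComponent_mem_coeffSpace (g : InvRing) (d m : ℕ) :
    (if d ≤ m then homogeneousComponent (m - d) (g : Poly) else 0) ∈ coeffSpace d m := by
  split_ifs with h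
  · rw [coeffSpace_of_le h]
    exact homogeneousComponent_mem_invDegree g _
  · exact Submodule.zero_mem _

theorem sum_smul_apply {n p : ℕ} (c : Fin n → Poly) (ω : Fin n → PolyForm p)
    (v : Fin p → Fin 3 → ℂ) : (∑ i, c i • ω i) v = ∑ i, c i * ω i v := by
  let ev : PolyForm p →+ Poly :=
    { toFun := fun α => α v, map_zero' := rfl, map_add' := fun _ _ => rfl }
  exact map_sum ev (fun i => c i • ω i) Finset.univ

/-- A homogeneous basis over the ring of invariants determines the dimensions of the homogeneous
parts of a module of forms. -/
theorem IsBasisOf.finrank_eq {p n : ℕ} {d : Fin n → ℕ} {ω : Fin n → PolyForm p}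
    {N : Submodule ℂ (PolyForm p)} (hb : IsBasisOf InvRing ω (N : Set (PolyForm p)))
    (hω : ∀ i, ω i ∈ homogeneousForms p (d i)) (m : ℕ) :
    Module.finrank ℂ ↥(N ⊓ homogeneousForms p m)
      = ∑ i, if d i ≤ m then Module.finrank ℂ (invDegree (m - d i)) else 0 := by
  let Φ : (∀ i, coeffSpace (d i) m) →ₗ[ℂ] PolyForm p :=
    { toFun := fun g => ∑ i, (g i : Poly) • ω i
      map_add' := fun g h => by simp [add_smul, Finset.sum_add_distrib]
      map_smul' := fun c g => by
        rw [RingHom.id_apply, Finset.smul_sum]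
        refine Finset.sum_congr rfl fun i _ => AlternatingMap.ext fun v => ?_
        exact smul_mul_assoc c (g i : Poly) (ω i v) }
  have hinj : Function.Injective Φ := by
    rw [injective_iff_map_eq_zero]
    intro g hg
    have h := Fintype.linearIndependent_iff.1 hb.1
      (fun i => ⟨g i, coeffSpace_le _ _ (g i).2⟩) hg
    ext1 i
    exact Subtype.ext (congrArg (Subtype.val : InvRing → Poly) (h i))
  have hrange : LinearMap.range Φ = N ⊓ homogeneousForms p m := by
    apply le_antisymm
    · rintro _ ⟨g, rfl⟩
      constructor
      · rw [← hb.2]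
        exact (Submodule.mem_span_range_iff_exists_fun InvRing).2
          ⟨fun i => ⟨g i, coeffSpace_le _ _ (g i).2⟩, rfl⟩
      · refine Submodule.sum_mem (homogeneousForms p m) fun i _ v => ?_
        change (g i : Poly) * ω i v ∈ _
        have hg := (g i).2
        generalize (g i : Poly) = q at hg ⊢
        by_cases hd : d i ≤ m
        · rw [coeffSpace_of_le hd] at hg
          have h := IsHomogeneous.mul hg.2 (hω i v)
          rwa [Nat.sub_add_cancel hd] at h
        · rw [coeffSpace_of_not_le hd, Submodule.mem_bot] at hg
          rw [hg, zero_mul]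
          exact Submodule.zero_mem _
    · rintro α ⟨hα, hα'⟩
      rw [← hb.2] at hα
      obtain ⟨c, rfl⟩ := (Submodule.mem_span_range_iff_exists_fun InvRing).1 hα
      -- only the parts of degree `m - d i` of the coefficients contribute in degree `m`
      refine ⟨fun i => ⟨_, homogeneousComponent_mem_coeffSpace (c i) (d i) m⟩, ?_⟩
      ext1 v
      refine (sum_smul_apply _ ω v).trans ?_
      have h := sum_smul_apply (fun i => (c i : Poly)) ω v
      refine Eq.trans ?_ (homogeneousComponent_eq_self (hα' v))
      refine Eq.trans ?_ (congrArg (homogeneousComponent m) h.symm)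
      rw [map_sum]
      refine Finset.sum_congr rfl fun i _ => ?_
      rw [homogeneousComponent_mul_of_isHomogeneous (hω i v), ite_mul, zero_mul]
  rw [← hrange, LinearMap.finrank_range_of_inj hinj, Module.finrank_pi_fintype]
  exact Finset.sum_congr rfl fun i _ => finrank_coeffSpace _ _

theorem coeff_molienSeries_zero (k : ℕ) :
    PowerSeries.coeff k (molienSeries V2160 0) = Module.finrank ℂ (invDegree k) := by
  let e : Poly ≃ₗ[ℂ] PolyForm 0 := LinearEquiv.ofBijective
    { toFun := zeroForm, map_add' := fun _ _ => rfl, map_smul' := fun _ _ => rfl }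
    ⟨zeroForm_injective, zeroForm_surjective⟩
  have h : (invDegree k).map e.toLinearMap = invariantForms V2160 0 ⊓ homogeneousForms 0 k := by
    ext α
    obtain ⟨f, rfl⟩ := zeroForm_surjective α
    constructor
    · rintro ⟨g, hg, hgf⟩
      rw [← hgf]
      exact ⟨zeroForm_mem_invariantForms.2 hg.1, zeroForm_mem_homogeneousForms.2 hg.2⟩
    · rintro ⟨h1, h2⟩
      exact ⟨f, ⟨zeroForm_mem_invariantForms.1 h1, zeroForm_mem_homogeneousForms.1 h2⟩, rfl⟩
  rw [molienSeries, PowerSeries.coeff_mk, ← h]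
  exact_mod_cast LinearEquiv.finrank_map_eq e (invDegree k)

theorem invDegree_zero : invDegree 0 = Submodule.span ℂ {1} := by
  apply le_antisymm
  · rintro f ⟨-, hf⟩
    have h : f = C (f.coeff 0) :=
      totalDegree_eq_zero_iff_eq_C.1 ((totalDegree_zero_iff_isHomogeneous _).2 hf)
    rw [Submodule.mem_span_singleton]
    exact ⟨f.coeff 0, by rw [smul_eq_C_mul, mul_one]; exact h.symm⟩
  · rw [Submodule.span_singleton_le_iff_mem]
    exact ⟨InvRing.one_mem, isHomogeneous_one _ _⟩

/-- The constant term of the Molien series is one: the only invariants of degree zero are the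
constants. -/
theorem isUnit_molienSeries : IsUnit (molienSeries V2160 0) := by
  rw [PowerSeries.isUnit_iff_constantCoeff, ← PowerSeries.coeff_zero_eq_constantCoeff_apply,
    coeff_molienSeries_zero, invDegree_zero, finrank_span_singleton one_ne_zero]
  simp

theorem IsBasisOf.molienSeries_eq {p n : ℕ} {d : Fin n → ℕ} {ω : Fin n → PolyForm p}
    (hb : IsBasisOf InvRing ω (invariantForms V1080 p : Set (PolyForm p)))
    (hω : ∀ i, ω i ∈ homogeneousForms p (d i)) :
    molienSeries V1080 p = (∑ i, PowerSeries.X ^ d i) * molienSeries V2160 0 := by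
  ext m
  rw [molienSeries, PowerSeries.coeff_mk, hb.finrank_eq hω, Finset.sum_mul, map_sum]
  push_cast
  refine Finset.sum_congr rfl fun i _ => ?_
  rw [PowerSeries.coeff_X_pow_mul', coeff_molienSeries_zero]

/-! ### The generators in each degree -/

theorem coeff_cubic {R : Type*} [Semiring R] (a b c d : R) :
    let q : R[X] := Polynomial.C a + Polynomial.C b * Polynomial.X
      + Polynomial.C c * Polynomial.X ^ 2 + Polynomial.C d * Polynomial.X ^ 3
    q.coeff 0 = a ∧ q.coeff 1 = b ∧ q.coeff 2 = c ∧ q.coeff 3 = d := by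
  simp [Polynomial.coeff_X, Polynomial.coeff_C, Polynomial.coeff_X_pow]

theorem coeff_quotientPolynomial_zero :
    quotientPolynomial.coeff 0 = ∑ i, Polynomial.X ^ (![0, 45] : Fin 2 → ℕ) i := by
  refine (coeff_cubic _ _ _ _).1.trans ?_
  simp [Fin.sum_univ_two]

theorem coeff_quotientPolynomial_one :
    quotientPolynomial.coeff 1
      = ∑ i, Polynomial.X ^ (![5, 11, 29, 44, 26, 20] : Fin 6 → ℕ) i := by
  refine (coeff_cubic _ _ _ _).2.1.trans ?_
  simp [Fin.sum_univ_six]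
  ring

theorem coeff_quotientPolynomial_two :
    quotientPolynomial.coeff 2
      = ∑ i, Polynomial.X ^ (![1, 19, 25, 40, 34, 16] : Fin 6 → ℕ) i := by
  refine (coeff_cubic _ _ _ _).2.2.1.trans ?_
  simp [Fin.sum_univ_six]
  ring

theorem coeff_quotientPolynomial_three :
    quotientPolynomial.coeff 3 = ∑ i, Polynomial.X ^ (![0, 45] : Fin 2 → ℕ) i := by
  refine (coeff_cubic _ _ _ _).2.2.2.trans ?_
  simp [Fin.sum_univ_two]

theorem natDegree_quotientPolynomial_lt : quotientPolynomial.natDegree < 4 := by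
  have h (a b c d : ℤ[X]) : (Polynomial.C a + Polynomial.C b * Polynomial.X
      + Polynomial.C c * Polynomial.X ^ 2 + Polynomial.C d * Polynomial.X ^ 3).natDegree ≤ 3 := by
    compute_degree
  exact Nat.lt_succ_of_le (h _ _ _ _)

theorem isBasisOf_scalarBasis : IsBasisOf InvRing ![1, jacobian] (scalarModule : Set Poly) :=
  isBasisOf_scalarModule isSkew_jacobian isHomogeneous_jacobian jacobian_ne_zero

theorem isHomogeneous_scalarBasis (i : Fin 2) :
    ((![1, jacobian] : Fin 2 → Poly) i).IsHomogeneous ((![0, 45] : Fin 2 → ℕ) i) := by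
  fin_cases i
  exacts [isHomogeneous_one _ _, isHomogeneous_jacobian]

theorem isBasisOf_twoForm_vecBasis :
    IsBasisOf InvRing (fun i => twoForm (vecBasis i))
      (invariantForms V1080 2 : Set (PolyForm 2)) :=
  isBasisOf_vecBasis.map twoFormEquiv fun _ => twoForm_mem_iff

/-- For every `p` the invariant `p`-forms have a homogeneous basis whose degrees are displayed by
the quotient polynomial. -/
theorem exists_basis_invariantForms (p : ℕ) (hp : p ≤ 3) :
    ∃ (n : ℕ) (d : Fin n → ℕ) (ω : Fin n → PolyForm p),
      quotientPolynomial.coeff p = ∑ i, Polynomial.X ^ d i ∧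
      (∀ i, ω i ∈ homogeneousForms p (d i)) ∧
      IsBasisOf InvRing ω (invariantForms V1080 p : Set (PolyForm p)) := by
  interval_cases p
  · exact ⟨2, _, _, coeff_quotientPolynomial_zero,
      fun i => zeroForm_mem_homogeneousForms.2 (isHomogeneous_scalarBasis i),
      isBasisOf_scalarBasis.map zeroFormEquiv fun _ => zeroForm_mem_iff⟩
  · exact ⟨6, _, _, coeff_quotientPolynomial_one,
      fun i => oneForm_mem_homogeneousForms (isHomField_covBasis i),
      isBasisOf_covBasis.map oneFormEquiv fun _ => oneForm_mem_iff⟩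
  · exact ⟨6, _, _, coeff_quotientPolynomial_two,
      fun i => twoForm_mem_homogeneousForms (isHomField_vecBasis i), isBasisOf_twoForm_vecBasis⟩
  · exact ⟨2, _, _, coeff_quotientPolynomial_three,
      fun i => threeForm_mem_homogeneousForms (isHomogeneous_scalarBasis i),
      isBasisOf_scalarBasis.map threeFormEquiv fun _ => threeForm_mem_iff⟩

theorem molienSeries_V1080 (p : ℕ) (hp : p ≤ 3) :
    molienSeries V1080 p
      = Polynomial.coeToPowerSeries.ringHom (quotientPolynomial.coeff p)
        * molienSeries V2160 0 := by
  obtain ⟨n, d, ω, hq, hω, hb⟩ := exists_basis_invariantForms p hp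
  rw [hb.molienSeries_eq hω, hq, map_sum]
  congr 1
  refine Finset.sum_congr rfl fun i _ => ?_
  rw [map_pow, Polynomial.coeToPowerSeries.ringHom_apply, Polynomial.coe_X]

theorem exteriorMolienSeries_V1080 :
    exteriorMolienSeries V1080
      = quotientPolynomial.map Polynomial.coeToPowerSeries.ringHom
        * Polynomial.C (molienSeries V2160 0) := by
  rw [exteriorMolienSeries]
  conv_rhs => rw [quotientPolynomial.as_sum_range' 4 natDegree_quotientPolynomial_lt,
    Polynomial.map_sum, Finset.sum_mul]
  refine Finset.sum_congr rfl fun p hp => ?_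
  rw [molienSeries_V1080 p (Nat.le_of_lt_succ (Finset.mem_range.1 hp)), Polynomial.map_monomial,
    ← Polynomial.C_mul_X_pow_eq_monomial, map_mul]
  ring

end Valentiner

end

theorem mainTheorem4 :
    -- the quotient of the two series is the explicit polynomial
    (IsUnit (Valentiner.molienSeries Valentiner.V2160 0) ∧
      Valentiner.exteriorMolienSeries Valentiner.V1080 =
        Valentiner.quotientPolynomial.map Polynomial.coeToPowerSeries.ringHom *
          Polynomial.C (Valentiner.molienSeries Valentiner.V2160 0)) ∧
    -- the coefficient of `s ^ p` displays the degrees of the generating invariant `p`-forms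
    (∀ p ≤ 3, ∃ (n : ℕ) (d : Fin n → ℕ) (ω : Fin n → Valentiner.PolyForm p),
      Valentiner.quotientPolynomial.coeff p = ∑ i, Polynomial.X ^ d i ∧
      (∀ i, ω i ∈ Valentiner.homogeneousForms p (d i)) ∧
      Valentiner.IsBasisOf (Valentiner.invariantRing Valentiner.V2160) ω
        (Valentiner.invariantForms Valentiner.V1080 p : Set (Valentiner.PolyForm p))) ∧
    -- for `p = 2` these are the degrees of the generating equivariant maps
    (∃ (n : ℕ) (d : Fin n → ℕ) (f : Fin n → Fin 3 → MvPolynomial (Fin 3) ℂ),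
      Valentiner.quotientPolynomial.coeff 2 = ∑ i, Polynomial.X ^ d i ∧
      (∀ i k, (f i k).IsHomogeneous (d i)) ∧
      Valentiner.IsBasisOf (Valentiner.invariantRing Valentiner.V2160) f
        {g | Valentiner.IsEquivariant Valentiner.V1080 g} ∧
      Valentiner.IsBasisOf (Valentiner.invariantRing Valentiner.V2160)
        (fun i => Valentiner.twoForm (f i))
        (Valentiner.invariantForms Valentiner.V1080 2 : Set (Valentiner.PolyForm 2))) := by
  have hset : {g | Valentiner.IsEquivariant Valentiner.V1080 g}
      = (Valentiner.vecModule : Set (Fin 3 → Valentiner.Poly)) :=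
    Set.ext fun _ => Valentiner.isEquivariant_iff
  refine ⟨⟨Valentiner.isUnit_molienSeries, Valentiner.exteriorMolienSeries_V1080⟩,
    Valentiner.exists_basis_invariantForms, 6, _, Valentiner.vecBasis,
    Valentiner.coeff_quotientPolynomial_two, Valentiner.isHomField_vecBasis, ?_,
    Valentiner.isBasisOf_twoForm_vecBasis⟩
  rw [hset]
  exact Valentiner.isBasisOf_vecBasis
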